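/- For a connected graph $G=(V,E)$ with root $r\in V$, demands $d_v\ge 0$ and resistances $\rho_e\ge 0$, the loss of a spanning tree $T=(V,F)$ is $$L(T)=\sum_{e\in F}\rho_e\Bigl(\sum_{v\in D_T(e)}d_v\Bigr)^2,$$ where $D_T(e)$ is the vertex set of the component of $T-e$ that does not contain $r$; the electrical distribution network reconfiguration problem asks for a spanning tree of minimum loss. An $n\times m$ grid ($n,m\ge1$) is a graph isomorphic to the Cartesian product of two paths with $n$ and $m$ vertices. Theorem. There are a deterministic algorithm (the Min-Min algorithm), a polynomial $p$ and a function $\varepsilon:\mathbb N\to\mathbb R$ with $\varepsilon(N)\to0$ as $N\to\infty$ such that the following holds. For every $n\times m$ grid $G$ with $N=nm$ vertices and every corner $r$ of $G$, where $d_v=1$ for all $v\ne r$ and $\rho_e=1$ for all $e$, the algorithm, given the adjacency matrix of $G$ (in an arbitrary labelling of the vertices) and the root $r$, halts after at most $p(N)$ steps and outputs a spanning tree $\tilde T$ of $G$ with $$L(\tilde T)\le\Bigl(\tfrac98+\varepsilon(N)\Bigr)L(T)\qquad\text{for every spanning tree }T\text{ of }G.$$ Moreover $\tilde T$ is a Min-Min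 tree: let $a=\min(n,m)$ and $b=\max(n,m)$, let $V_k$ be the set of the vertices at distance $k$ from $r$ in $G$, and let $\tilde T_v$ be the subtree of $\tilde T$ formed by $v$ and its descendants. Then every vertex has the same distance from $r$ in $\tilde T$ as in $G$, and (a) for $a-1\le k\le b-1$, the subtrees $\tilde T_v$ with $v\in V_k$ are paths starting at $v$, of pairwise different lengths; (b) for $1\le k\le a-2$, exactly one vertex $z\in V_k$ has degree three in $\tilde T$, the other vertices of $V_k$ have degree two, and the two children of $z$ are two vertices $v\in V_{k+1}$ whose subtrees $\tilde T_v$ are the smallest. -/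

import Mathlib

open Filter Topology

/-! ## The electrical distribution network reconfiguration problem -/

section Network

variable {V : Type*}

/-- `T` is a spanning tree of `G`. -/
def IsSpanningTree (G T : SimpleGraph V) : Prop :=
  T ≤ G ∧ T.IsTree

/-- The vertices in the components of `T - e` that do not contain the root `r`. -/
def descendants (T : SimpleGraph V) (r : V) (e : Sym2 V) : Set V :=
  {v | ¬ (T.deleteEdges {e}).Reachable r v}

open Classical in
/-- The loss of the spanning tree `T` with root `r`, demands `d` and resistances `ρ`.
The value `d r` plays no role, as `r` is never a descendant of an edge. -/
noncomputable def loss [Fintype V] (T : SimpleGraph V) (r : V) (d : V → ℝ) (ρ : Sym2 V → ℝ) : ℝ :=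
  ∑ e ∈ T.edgeFinset, ρ e * (∑ v ∈ (descendants T r e).toFinset, d v) ^ 2

/-- `G` is an `n × m` grid (a graph isomorphic to the Cartesian product of two paths, with `n` and
`m` vertices) in which the vertex `r` is one of the corners. -/
def IsGridWithCorner (n m : ℕ) (G : SimpleGraph V) (r : V) : Prop :=
  ∃ φ : G ≃g (SimpleGraph.pathGraph n □ SimpleGraph.pathGraph m),
    (((φ r).1 : ℕ) = 0 ∨ ((φ r).1 : ℕ) + 1 = n) ∧ (((φ r).2 : ℕ) = 0 ∨ ((φ r).2 : ℕ) + 1 = m)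

/-! ## Min-Min trees -/

/-- The vertex set of the subtree hanging at `v`: all `u` such that `v` lies on the path of `T`
from the root `r` to `u`. -/
def subtreeAt (T : SimpleGraph V) (r v : V) : Set V :=
  {u | ∃ p : T.Walk r u, p.IsPath ∧ v ∈ p.support}

/-- The trees that the Min-Min algorithm builds on a grid `G` with sides `n ≤ m` and root `r` at a
corner. The layer `k` consists of the vertices at distance `k` from `r`. -/
structure IsMinMinTree (n m : ℕ) (G : SimpleGraph V) (r : V) (T : SimpleGraph V) : Prop where
  /-- `T` is a spanning tree. -/
  spanning : IsSpanningTree G T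
  /-- `T` is a shortest-path tree: the parent of a vertex is in the previous layer. -/
  shortest : ∀ v, T.dist r v = G.dist r v
  /-- For a layer `n - 1 ≤ k ≤ m - 1`, the subtrees at the vertices of the layer are paths
  (which start at these vertices) ... -/
  path : ∀ v, n ≤ G.dist r v + 1 → G.dist r v + 1 ≤ m →
    ∃ (w : V) (p : T.Walk v w), p.IsPath ∧ {u | u ∈ p.support} = subtreeAt T r v
  /-- ... of pairwise different lengths. -/
  distinct : ∀ u v, n ≤ G.dist r v + 1 → G.dist r v + 1 ≤ m → G.dist r u = G.dist r v → u ≠ v →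
    (subtreeAt T r u).ncard ≠ (subtreeAt T r v).ncard
  /-- In a layer `1 ≤ k ≤ n - 2`, exactly one vertex `z` has degree three, all others have degree
  two, and the two children of `z` are those vertices of the layer `k + 1` whose subtrees are the
  smallest two. -/
  merge : ∀ k, 1 ≤ k → k + 2 ≤ n → ∃ z, G.dist r z = k ∧ (T.neighborSet z).ncard = 3 ∧
    (∀ v, G.dist r v = k → v ≠ z → (T.neighborSet v).ncard = 2) ∧
    ∃ x y, x ≠ y ∧ G.dist r x = k + 1 ∧ G.dist r y = k + 1 ∧ T.Adj z x ∧ T.Adj z y ∧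
      ∀ w, G.dist r w = k + 1 → w ≠ x → w ≠ y →
        (subtreeAt T r x).ncard ≤ (subtreeAt T r w).ncard ∧
        (subtreeAt T r y).ncard ≤ (subtreeAt T r w).ncard

end Network

/-! ## A random access machine with a step count

Structured programs on finitely many registers and finitely many (unbounded) arrays of natural
numbers. The arithmetic operations are addition and truncated subtraction only, so that a number
grows by a bounded number of bits per step, and polynomial time here is the usual polynomial
time. -/

namespace Ram

/-- A memory: the contents of the registers, and of the arrays. -/
structure Store where
  reg : ℕ → ℕ
  arr : ℕ → ℕ → ℕ

/-- Expressions: a constant, a register, the entry of array `a` at a computed index, a sum, and a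
truncated difference. -/
inductive Expr where
  | const (c : ℕ)
  | reg (i : ℕ)
  | cell (a : ℕ) (e : Expr)
  | add (e f : Expr)
  | sub (e f : Expr)

/-- The value of an expression. -/
def Expr.eval (s : Store) : Expr → ℕ
  | const c => c
  | reg i => s.reg i
  | cell a e => s.arr a (e.eval s)
  | add e f => e.eval s + f.eval s
  | sub e f => e.eval s - f.eval s

/-- The number of steps for evaluating an expression. -/
def Expr.cost : Expr → ℕ
  | const _ => 1
  | reg _ => 1
  | cell _ e => e.cost + 1
  | add e f => e.cost + f.cost + 1
  | sub e f => e.cost + f.cost + 1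

/-- Programs. -/
inductive Program where
  /-- do nothing -/
  | skip
  /-- register `i` := `e` -/
  | assign (i : ℕ) (e : Expr)
  /-- entry `e` of array `a` := `f` -/
  | write (a : ℕ) (e f : Expr)
  /-- first `c`, then `d` -/
  | seq (c d : Program)
  /-- if `e < f` then `c` else `d` -/
  | ifLt (e f : Expr) (c d : Program)
  /-- while `e < f` do `c` -/
  | whileLt (e f : Expr) (c : Program)

/-- `Exec c s s' t`: started with the memory `s`, the program `c` halts after `t` steps with the
memory `s'`. -/
inductive Exec : Program → Store → Store → ℕ → Prop where
  | skip (s : Store) : Exec .skip s s 1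
  | assign (i : ℕ) (e : Expr) (s : Store) :
      Exec (.assign i e) s ⟨Function.update s.reg i (e.eval s), s.arr⟩ (e.cost + 1)
  | write (a : ℕ) (e f : Expr) (s : Store) :
      Exec (.write a e f) s
        ⟨s.reg, Function.update s.arr a (Function.update (s.arr a) (e.eval s) (f.eval s))⟩
        (e.cost + f.cost + 1)
  | seq {c d : Program} {s s' s'' : Store} {t t' : ℕ} :
      Exec c s s' t → Exec d s' s'' t' → Exec (.seq c d) s s'' (t + t')
  | ifLt_true {e f : Expr} {c d : Program} {s s' : Store} {t : ℕ} :
      e.eval s < f.eval s → Exec c s s' t → Exec (.ifLt e f c d) s s' (e.cost + f.cost + 1 + t)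
  | ifLt_false {e f : Expr} {c d : Program} {s s' : Store} {t : ℕ} :
      ¬ e.eval s < f.eval s → Exec d s s' t → Exec (.ifLt e f c d) s s' (e.cost + f.cost + 1 + t)
  | whileLt_true {e f : Expr} {c : Program} {s s' s'' : Store} {t t' : ℕ} :
      e.eval s < f.eval s → Exec c s s' t → Exec (.whileLt e f c) s' s'' t' →
        Exec (.whileLt e f c) s s'' (e.cost + f.cost + 1 + t + t')
  | whileLt_false {e f : Expr} {c : Program} {s : Store} :
      ¬ e.eval s < f.eval s → Exec (.whileLt e f c) s s (e.cost + f.cost + 1)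

open Classical in
/-- The initial memory for a graph `G` with vertices `0, …, N - 1` and root `r`: register `0` holds
`N`, register `1` holds `r`, array `0` holds the adjacency matrix of `G` row by row, and everything
else is `0`. -/
noncomputable def input {N : ℕ} (G : SimpleGraph (Fin N)) (r : Fin N) : Store where
  reg i := if i = 0 then N else if i = 1 then r else 0
  arr a x := if a = 0 ∧ ∃ u v : Fin N, x = u * N + v ∧ G.Adj u v then 1 else 0

/-- The graph on the vertices `0, …, N - 1` that a memory represents as an output: `u ≠ v` are
adjacent if the entry `(u, v)` or the entry `(v, u)` of the `N × N` matrix in array `1` is not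
zero. -/
def output (N : ℕ) (s : Store) : SimpleGraph (Fin N) :=
  SimpleGraph.fromRel fun u v : Fin N => s.arr 1 (u * N + v) ≠ 0

end Ram

/-! Lower bound. Let `T` be any spanning tree, `V_k` the set of vertices at distance `k` from the
root in `G`, and `S_k` the number of vertices at distance at least `k`. Along the path of `T` from a
vertex to the root the distance in `G` changes by at most one per step, so a path starting at
distance at least `k` meets `V_k`. Hence the subtree sizes over `V_k` add up to at least `S_k`, and
by Cauchy–Schwarz the parent edges of `V_k` contribute at least `S_k ^ 2 / |V_k|` to the loss
(`sum_le_loss`).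

Upper bound. In a Min-Min tree the sizes over `V_k` add up to at most `S_k`. If the largest is at
most twice the smallest, a reverse Cauchy–Schwarz inequality (`card_mul_sum_sq_le`) bounds the
contribution of the layer by `9/8` times the lower bound. Towards the root, the sizes start as `b -
a + 1, …, b` in layer `a - 1`, and then the two smallest are merged in each layer. Once a merged
subtree is the largest, the ratio is at most two, and later merges preserve this
(`mergeSizes_balanced`). The layers where the ratio may be larger number at most `3a + 1` and cost
at most `2bN` each (`IsRanking.loss_le`), which is `O(N ^ 2)` in total. Every spanning tree has loss
at least `N ^ 2 / 4` times a divergent harmonic sum (`GridCoord.mul_layerSum_le`), so this excess is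
relatively negligible.

Embedding. The merges are chosen by size alone, ignoring the geometry. This is possible because any
vertex of a diagonal can be the one with two children: the vertices on one side of it keep their
positions, those on the other side shift by one (`layerPos_injOn_and_lt`).

Algorithm. The distances from the root, from a neighbour of it and from an adjacent corner recover
the layers and the order along each diagonal; the rest is filling tables
(`Ram.Cmd.isRanking_output`). The program is written in a loop language in which the running time is
polynomial by construction (`exec_compile`). -/

/-! ## Bounded loop programs -/

namespace Ram

/-- Programs whose loops all run through `0, …, N - 1`, where `N` is the content of register `0`,
and whose data are kept in the arrays. The loop variable of a loop that lies inside `l` other loops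
is register `l + 2`. -/
inductive Cmd where
  | write (a : ℕ) (e f : Expr)
  | seq (c d : Cmd)
  | ifLt (e f : Expr) (c d : Cmd)
  | skip
  | loop (c : Cmd)

namespace Cmd

/-- The program of a command that lies inside `l` loops. -/
def compile : Cmd → ℕ → Program
  | write a e f, _ => .write a e f
  | seq c d, l => .seq (c.compile l) (d.compile l)
  | ifLt e f c d, l => .ifLt e f (c.compile l) (d.compile l)
  | skip, _ => .skip
  | loop c, l =>
    .seq (.assign (l + 2) (.const 0))
      (.seq (.whileLt (.reg (l + 2)) (.reg 0)
        (.seq (c.compile (l + 1)) (.assign (l + 2) (.add (.reg (l + 2)) (.const 1)))))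
        (.assign (l + 2) (.const 0)))

/-- The effect of a command inside `l` loops on the arrays. -/
def run : Cmd → ℕ → (ℕ → ℕ) → (ℕ → ℕ → ℕ) → (ℕ → ℕ → ℕ)
  | write a e f, _, ρ, A =>
    Function.update A a (Function.update (A a) (e.eval ⟨ρ, A⟩) (f.eval ⟨ρ, A⟩))
  | seq c d, l, ρ, A => d.run l ρ (c.run l ρ A)
  | ifLt e f c d, l, ρ, A => if e.eval ⟨ρ, A⟩ < f.eval ⟨ρ, A⟩ then c.run l ρ A else d.run l ρ A
  | skip, _, _, A => A
  | loop c, l, ρ, A =>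
    Nat.rec A (fun k B => c.run (l + 1) (Function.update ρ (l + 2) k) B) (ρ 0)

/-- A bound for the number of steps, as a polynomial in the content of register `0`. -/
noncomputable def bound : Cmd → Polynomial ℕ
  | write _ e f => ((e.cost + f.cost + 1 : ℕ) : Polynomial ℕ)
  | seq c d => c.bound + d.bound
  | ifLt e f c d => ((e.cost + f.cost + 1 : ℕ) : Polynomial ℕ) + (c.bound + d.bound)
  | skip => ((1 : ℕ) : Polynomial ℕ)
  | loop c => Polynomial.X * (c.bound + ((7 : ℕ) : Polynomial ℕ)) + ((7 : ℕ) : Polynomial ℕ)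

/-- A loop register is zero before its loop and is reset afterwards, so a command leaves all
registers unchanged, and `run` has to follow the arrays only. -/
theorem exec_compile (c : Cmd) : ∀ (l : ℕ) (ρ : ℕ → ℕ) (A : ℕ → ℕ → ℕ), (∀ i, l + 2 ≤ i → ρ i = 0) →
    ∃ t, Exec (c.compile l) ⟨ρ, A⟩ ⟨ρ, c.run l ρ A⟩ t ∧ t ≤ c.bound.eval (ρ 0) := by
  induction c with
  | write a e f =>
    intro l ρ A _
    exact ⟨_, Exec.write a e f ⟨ρ, A⟩, by simp [bound]⟩
  | skip =>
    intro l ρ A _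
    exact ⟨_, Exec.skip _, by simp [bound]⟩
  | seq c d hc hd =>
    intro l ρ A h
    obtain ⟨t, ht, ht'⟩ := hc l ρ A h
    obtain ⟨u, hu, hu'⟩ := hd l ρ (c.run l ρ A) h
    exact ⟨_, ht.seq hu, by simp only [bound, Polynomial.eval_add]; omega⟩
  | ifLt e f c d hc hd =>
    intro l ρ A h
    by_cases hlt : e.eval ⟨ρ, A⟩ < f.eval ⟨ρ, A⟩
    · obtain ⟨t, ht, ht'⟩ := hc l ρ A h
      refine ⟨_, by simpa [run, hlt, compile] using Exec.ifLt_true hlt ht, ?_⟩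
      simp only [bound, Polynomial.eval_add, Polynomial.eval_natCast, Nat.cast_id]
      omega
    · obtain ⟨t, ht, ht'⟩ := hd l ρ A h
      refine ⟨_, by simpa [run, hlt, compile] using Exec.ifLt_false hlt ht, ?_⟩
      simp only [bound, Polynomial.eval_add, Polynomial.eval_natCast, Nat.cast_id]
      omega
  | loop c hc =>
    intro l ρ A h
    set B : ℕ → ℕ → ℕ → ℕ := fun k =>
      Nat.rec A (fun k B => c.run (l + 1) (Function.update ρ (l + 2) k) B) k with hB
    set W : Program := .whileLt (.reg (l + 2)) (.reg 0)
        (.seq (c.compile (l + 1)) (.assign (l + 2) (.add (.reg (l + 2)) (.const 1)))) with hW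
    have h0 : ∀ k, Function.update ρ (l + 2) k 0 = ρ 0 := fun k => by
      rw [Function.update_of_ne (by omega)]
    -- `j` is the number of remaining rounds. Besides the body, a round pays 3 steps for the test
    -- and 4 for the increment; the final 3 is the failing test.
    have key : ∀ j k, k + j = ρ 0 → ∃ t,
        Exec W ⟨Function.update ρ (l + 2) k, B k⟩ ⟨Function.update ρ (l + 2) (ρ 0), B (ρ 0)⟩ t ∧
          t ≤ j * (c.bound.eval (ρ 0) + 7) + 3 := by
      intro j
      induction j with
      | zero =>
        intro k hk
        obtain rfl : k = ρ 0 := by omega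
        refine ⟨_, Exec.whileLt_false ?_, ?_⟩
        · simp [Expr.eval]
        · simp [Expr.cost]
      | succ j ih =>
        intro k hk
        obtain ⟨u, hu, hu'⟩ := ih (k + 1) (by omega)
        obtain ⟨t, ht, ht'⟩ := hc (l + 1) (Function.update ρ (l + 2) k) (B k) (by
          intro i hi
          rw [Function.update_of_ne (by omega)]
          exact h i (by omega))
        rw [h0] at ht'
        have h1 : Exec (.assign (l + 2) (.add (.reg (l + 2)) (.const 1)))
            ⟨Function.update ρ (l + 2) k, B (k + 1)⟩
            ⟨Function.update ρ (l + 2) (k + 1), B (k + 1)⟩ 4 := by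
          have := Exec.assign (l + 2) (.add (.reg (l + 2)) (.const 1))
            ⟨Function.update ρ (l + 2) k, B (k + 1)⟩
          simpa [Expr.eval, Expr.cost] using this
        refine ⟨_, Exec.whileLt_true ?_ (ht.seq h1) hu, ?_⟩
        · simp only [Expr.eval, Function.update_self, h0]
          omega
        · simp only [Expr.cost]
          have : (j + 1) * (c.bound.eval (ρ 0) + 7) = j * (c.bound.eval (ρ 0) + 7) +
            (c.bound.eval (ρ 0) + 7) := by ring
          omega
    obtain ⟨t, ht, ht'⟩ := key (ρ 0) 0 (by omega)
    have e0 : Function.update ρ (l + 2) 0 = ρ := by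
      rw [← h (l + 2) le_rfl, Function.update_eq_self]
    have h1 : Exec (.assign (l + 2) (.const 0)) ⟨ρ, A⟩ ⟨Function.update ρ (l + 2) 0, B 0⟩ 2 := by
      simpa [Expr.eval, Expr.cost, hB] using Exec.assign (l + 2) (.const 0) ⟨ρ, A⟩
    have h2 : Exec (.assign (l + 2) (.const 0)) ⟨Function.update ρ (l + 2) (ρ 0), B (ρ 0)⟩
        ⟨ρ, B (ρ 0)⟩ 2 := by
      simpa [Expr.eval, Expr.cost, e0] using
        Exec.assign (l + 2) (.const 0) ⟨Function.update ρ (l + 2) (ρ 0), B (ρ 0)⟩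
    refine ⟨_, h1.seq (ht.seq h2), ?_⟩
    simp only [bound, Polynomial.eval_add, Polynomial.eval_mul, Polynomial.eval_X,
      Polynomial.eval_natCast, Nat.cast_id]
    omega

/-- The arrays that a command can change. -/
def writes : Cmd → List ℕ
  | write a _ _ => [a]
  | seq c d => c.writes ++ d.writes
  | ifLt _ _ c d => c.writes ++ d.writes
  | skip => []
  | loop c => c.writes

theorem run_of_notMem_writes (c : Cmd) : ∀ (l : ℕ) (ρ : ℕ → ℕ) (A : ℕ → ℕ → ℕ) (a : ℕ),
    a ∉ c.writes → c.run l ρ A a = A a := by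
  induction c with
  | write b e f =>
    intro l ρ A a h
    simp only [writes, List.mem_singleton] at h
    simp [run, h]
  | skip => intros; rfl
  | seq c d hc hd =>
    intro l ρ A a h
    simp only [writes, List.mem_append, not_or] at h
    rw [run, hd _ _ _ _ h.2, hc _ _ _ _ h.1]
  | ifLt e f c d hc hd =>
    intro l ρ A a h
    simp only [writes, List.mem_append, not_or] at h
    rw [run]
    split_ifs
    · exact hc _ _ _ _ h.1
    · exact hd _ _ _ _ h.2
  | loop c hc =>
    intro l ρ A a h
    simp only [run]
    induction ρ 0 with
    | zero => rfl
    | succ k ih => rw [← ih]; exact hc _ _ _ _ h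

/-- The invariant rule for a loop, where an array that the body does not change can be assumed to
have its initial value. -/
theorem run_loop {c : Cmd} {l : ℕ} {ρ : ℕ → ℕ} {A : ℕ → ℕ → ℕ} (I : ℕ → (ℕ → ℕ → ℕ) → Prop)
    (h0 : I 0 A)
    (hstep : ∀ k B, k < ρ 0 → (∀ a, a ∉ c.writes → B a = A a) → I k B →
      I (k + 1) (c.run (l + 1) (Function.update ρ (l + 2) k) B)) :
    I (ρ 0) ((loop c).run l ρ A) := by
  have : ∀ k ≤ ρ 0, I k (Nat.rec A (fun k B => c.run (l + 1) (Function.update ρ (l + 2) k) B) k) ∧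
      ∀ a, a ∉ c.writes →
        (Nat.rec A (fun k B => c.run (l + 1) (Function.update ρ (l + 2) k) B) k : ℕ → ℕ → ℕ) a
          = A a := by
    intro k
    induction k with
    | zero => exact fun _ => ⟨h0, fun _ _ => rfl⟩
    | succ k ih =>
      intro hk
      obtain ⟨h1, h2⟩ := ih (by omega)
      refine ⟨hstep k _ (by omega) h2 h1, fun a ha => ?_⟩
      rw [← h2 a ha]
      exact run_of_notMem_writes _ _ _ _ _ ha
  exact (this _ le_rfl).1

end Cmd

end Ram

/-! ## Rooted trees given by parent maps -/

section ParentMap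

variable {V : Type*}

/-- The edges of `T` join the vertices `v ≠ r` to their parents `par v`, which are one level closer
to the root `r`. -/
structure IsParentMap (T : SimpleGraph V) (r : V) (par : V → V) (lev : V → ℕ) : Prop where
  lev_root : lev r = 0
  lev_par : ∀ v, v ≠ r → lev (par v) + 1 = lev v
  adj : ∀ u v, T.Adj u v ↔ (v ≠ r ∧ par v = u) ∨ (u ≠ r ∧ par u = v)

/-- `u` is `v` or a descendant of `v`. -/
def Below (par : V → V) (lev : V → ℕ) (v u : V) : Prop :=
  lev v ≤ lev u ∧ par^[lev u - lev v] u = v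

open Classical in
/-- The number of descendants of `v`, including `v`. -/
noncomputable def subtreeSize [Fintype V] (par : V → V) (lev : V → ℕ) (v : V) : ℕ :=
  (Finset.univ.filter (Below par lev v)).card

namespace IsParentMap

variable {T : SimpleGraph V} {r : V} {par : V → V} {lev : V → ℕ}

theorem below_refl (v : V) : Below par lev v v := by simp [Below]

theorem eq_root (h : IsParentMap T r par lev) {v : V} (hv : lev v = 0) : v = r := by
  by_contra hr
  have := h.lev_par v hr
  omega

theorem below_iff (h : IsParentMap T r par lev) {u v : V} (hu : u ≠ r) :
    Below par lev v u ↔ u = v ∨ Below par lev v (par u) := by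
  have hl := h.lev_par u hu
  constructor
  · rintro ⟨h1, h2⟩
    rcases h1.eq_or_lt with h1 | h1
    · left
      simpa [h1] using h2
    · right
      refine ⟨by omega, ?_⟩
      obtain ⟨j, hj⟩ : ∃ j, lev u - lev v = j + 1 := ⟨lev u - lev v - 1, by omega⟩
      rw [hj, Function.iterate_succ_apply] at h2
      rwa [show lev (par u) - lev v = j by omega]
  · rintro (rfl | ⟨h1, h2⟩)
    · exact below_refl _
    · refine ⟨by omega, ?_⟩
      rw [show lev u - lev v = (lev (par u) - lev v) + 1 by omega, Function.iterate_succ_apply, h2]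

theorem below_root_iff (h : IsParentMap T r par lev) {v : V} : Below par lev v r ↔ v = r := by
  constructor
  · rintro ⟨h1, -⟩
    exact h.eq_root (by have := h.lev_root; omega)
  · rintro rfl
    exact below_refl _

theorem induction (h : IsParentMap T r par lev) {P : V → Prop} (root : P r)
    (step : ∀ u, u ≠ r → P (par u) → P u) (u : V) : P u := by
  induction hn : lev u using Nat.strong_induction_on generalizing u with
  | _ n ih =>
    by_cases hu : u = r
    · exact hu ▸ root
    · have := h.lev_par u hu
      exact step u hu (ih _ (by omega) _ rfl)

theorem below_par_of_below (h : IsParentMap T r par lev) {c : V} (hc : c ≠ r) (u : V) :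
    Below par lev c u → Below par lev (par c) u := by
  induction u using h.induction with
  | root => exact fun hr => (hc (h.below_root_iff.1 hr)).elim
  | step u hu ih =>
    intro hb
    rcases (h.below_iff hu).1 hb with rfl | hb
    · exact (h.below_iff hu).2 (Or.inr (below_refl _))
    · exact (h.below_iff hu).2 (Or.inr (ih hb))

theorem below_iff_child (h : IsParentMap T r par lev) {v : V} (u : V) :
    Below par lev v u ↔ u = v ∨ ∃ c, c ≠ r ∧ par c = v ∧ Below par lev c u := by
  constructor
  · induction u using h.induction with
    | root => exact fun hr => Or.inl (h.below_root_iff.1 hr).symm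
    | step u hu ih =>
      intro hb
      rcases (h.below_iff hu).1 hb with rfl | hb
      · exact Or.inl rfl
      · rcases ih hb with e | ⟨c, hc, e, hcu⟩
        · exact Or.inr ⟨u, hu, e, below_refl _⟩
        · exact Or.inr ⟨c, hc, e, (h.below_iff hu).2 (Or.inr hcu)⟩
  · rintro (rfl | ⟨c, hc, rfl, hcu⟩)
    · exact below_refl _
    · exact h.below_par_of_below hc u hcu

theorem below_unique {v w u : V} (hv : Below par lev v u) (hw : Below par lev w u)
    (e : lev v = lev w) : v = w := by
  rw [← hv.2, ← hw.2, e]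

/-- A discrete intermediate value argument: `g` drops by at most one per step towards the root,
where it is zero. In the application `g` is the distance in `G`, whereas `lev` is the distance in
`T`. -/
theorem exists_below_level (h : IsParentMap T r par lev) {g : V → ℕ} (hr : g r = 0)
    (hg : ∀ u, u ≠ r → g u ≤ g (par u) + 1) (k : ℕ) (u : V) :
    k ≤ g u → ∃ v, g v = k ∧ Below par lev v u := by
  induction u using h.induction with
  | root => exact fun hk => ⟨r, by omega, below_refl _⟩
  | step u hu ih =>
    intro hk
    rcases hk.eq_or_lt with e | hlt
    · exact ⟨u, e.symm, below_refl _⟩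
    · have := hg u hu
      obtain ⟨v, hv, hb⟩ := ih (by omega)
      exact ⟨v, hv, (h.below_iff hu).2 (Or.inr hb)⟩

theorem adj_par (h : IsParentMap T r par lev) {v : V} (hv : v ≠ r) : T.Adj v (par v) :=
  (h.adj _ _).2 (Or.inr ⟨hv, rfl⟩)

theorem exists_path (h : IsParentMap T r par lev) (u : V) :
    ∃ p : T.Walk u r, p.IsPath ∧ p.length = lev u ∧ ∀ x, x ∈ p.support ↔ Below par lev x u := by
  induction u using h.induction with
  | root => exact ⟨.nil, by simp, by simp [h.lev_root], by simp [h.below_root_iff]⟩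
  | step u hu ih =>
    obtain ⟨p, hp, hl, hs⟩ := ih
    have hlev := h.lev_par u hu
    refine ⟨.cons (h.adj_par hu) p, ?_, by simp [hl, hlev], fun x => ?_⟩
    · rw [SimpleGraph.Walk.cons_isPath_iff]
      refine ⟨hp, fun hmem => ?_⟩
      have := ((hs u).1 hmem).1
      omega
    · rw [SimpleGraph.Walk.support_cons, List.mem_cons, hs, h.below_iff hu, eq_comm]

theorem connected (h : IsParentMap T r par lev) : T.Connected := by
  rw [SimpleGraph.connected_iff_exists_forall_reachable]
  exact ⟨r, fun u => (h.exists_path u).choose.reachable.symm⟩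

theorem lev_le_of_walk (h : IsParentMap T r par lev) {u v : V} (p : T.Walk u v) :
    lev v ≤ lev u + p.length := by
  induction p with
  | nil => simp
  | cons hadj p ih =>
    rw [SimpleGraph.Walk.length_cons]
    rcases (h.adj _ _).1 hadj with ⟨h1, rfl⟩ | ⟨h1, rfl⟩
    · have := h.lev_par _ h1
      omega
    · have := h.lev_par _ h1
      omega

theorem dist_root (h : IsParentMap T r par lev) (v : V) : T.dist r v = lev v := by
  apply le_antisymm
  · obtain ⟨p, -, hl, -⟩ := h.exists_path v
    rw [SimpleGraph.dist_comm, ← hl]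
    exact SimpleGraph.dist_le p
  · obtain ⟨p, hp⟩ := h.connected.exists_walk_length_eq_dist r v
    have := h.lev_le_of_walk p
    rw [h.lev_root] at this
    omega

/-- The edge from a vertex to its parent. -/
theorem parEdge_injOn (h : IsParentMap T r par lev) {u v : V} (hu : u ≠ r) (hv : v ≠ r)
    (e : s(u, par u) = s(v, par v)) : u = v := by
  rw [Sym2.eq_iff] at e
  rcases e with ⟨e, -⟩ | ⟨e1, e2⟩
  · exact e
  · have h1 := h.lev_par u hu
    have h2 := h.lev_par v hv
    rw [e2] at h1
    rw [← e1] at h2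
    omega

theorem mem_edgeSet_iff (h : IsParentMap T r par lev) (e : Sym2 V) :
    e ∈ T.edgeSet ↔ ∃ v, v ≠ r ∧ s(v, par v) = e := by
  induction e using Sym2.ind with
  | _ u v =>
    rw [SimpleGraph.mem_edgeSet, h.adj]
    constructor
    · rintro (⟨h1, rfl⟩ | ⟨h1, rfl⟩)
      · exact ⟨v, h1, Sym2.eq_swap⟩
      · exact ⟨u, h1, rfl⟩
    · rintro ⟨w, hw, e⟩
      rw [Sym2.eq_iff] at e
      rcases e with ⟨rfl, rfl⟩ | ⟨rfl, rfl⟩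
      · exact Or.inr ⟨hw, rfl⟩
      · exact Or.inl ⟨hw, rfl⟩

/-- Mapping a non-root vertex to its parent edge is a bijection onto the edges, so `T` is connected
with one edge fewer than vertices. -/
theorem isTree [Finite V] (h : IsParentMap T r par lev) : T.IsTree := by
  rw [SimpleGraph.isTree_iff_connected_and_card]
  refine ⟨h.connected, ?_⟩
  have e : T.edgeSet = (fun v => s(v, par v)) '' {v | v ≠ r} := by
    ext e
    rw [h.mem_edgeSet_iff]
    rfl
  rw [Nat.card_coe_set_eq, e, Set.InjOn.ncard_image (s := {v | v ≠ r}) fun u hu v hv => h.parEdge_injOn hu hv]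
  have : {v : V | v ≠ r} = {r}ᶜ := by ext; simp
  rw [this, ← Set.ncard_add_ncard_compl {r}, Set.ncard_singleton, add_comm]

theorem subtreeAt_eq [Finite V] (h : IsParentMap T r par lev) (v : V) :
    subtreeAt T r v = {u | Below par lev v u} := by
  ext u
  obtain ⟨q, hq, -, hs⟩ := h.exists_path u
  constructor
  · rintro ⟨p, hp, hv⟩
    have := (h.isTree.isAcyclic.subsingleton_path r u).elim ⟨p, hp⟩ ⟨q.reverse, hq.reverse⟩
    have e : p = q.reverse := congrArg Subtype.val this
    rw [e, SimpleGraph.Walk.support_reverse, List.mem_reverse] at hv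
    exact (hs v).1 hv
  · intro hb
    exact ⟨q.reverse, hq.reverse, by
      rw [SimpleGraph.Walk.support_reverse, List.mem_reverse]
      exact (hs v).2 hb⟩

/-- The way to the root from a vertex that is not below `v` avoids the deleted edge; conversely,
that edge is the only one leaving the set of vertices below `v`. -/
theorem descendants_eq (h : IsParentMap T r par lev) {v : V} (hv : v ≠ r) :
    descendants T r s(v, par v) = {u | Below par lev v u} := by
  have hadj : ∀ u, u ≠ r → u ≠ v → (T.deleteEdges {s(v, par v)}).Adj u (par u) := by
    intro u hu huv
    rw [SimpleGraph.deleteEdges_adj]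
    exact ⟨h.adj_par hu, fun e => huv (h.parEdge_injOn hu hv e)⟩
  ext u
  simp only [descendants, Set.mem_ofPred_eq]
  constructor
  · contrapose!
    induction u using h.induction with
    | root => exact fun _ => SimpleGraph.Reachable.refl _
    | step u hu ih =>
      intro hb
      rw [h.below_iff hu, not_or] at hb
      exact (ih hb.2).trans (hadj u hu hb.1).reachable.symm
  · intro hb hreach
    have key : ∀ x y, (T.deleteEdges {s(v, par v)}).Walk x y → Below par lev v y →
        Below par lev v x := by
      intro x y p
      induction p with
      | nil => exact id
      | @cons x y z hxy p ih =>
        intro hz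
        have hy := ih hz
        rw [SimpleGraph.deleteEdges_adj] at hxy
        rcases (h.adj _ _).1 hxy.1 with ⟨h1, rfl⟩ | ⟨h1, rfl⟩
        · rcases (h.below_iff h1).1 hy with rfl | hb
          · exact (hxy.2 Sym2.eq_swap).elim
          · exact hb
        · exact (h.below_iff h1).2 (Or.inr hy)
    obtain ⟨p⟩ := hreach
    exact hv (h.below_root_iff.1 (key _ _ p hb))

theorem ncard_below [Fintype V] (v : V) :
    {u | Below par lev v u}.ncard = subtreeSize par lev v := by
  classical
  rw [subtreeSize, ← Set.ncard_coe_finset]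
  congr 1
  ext
  simp

open Classical in
theorem loss_eq [Fintype V] (h : IsParentMap T r par lev) :
    loss T r (fun _ => 1) (fun _ => 1) =
      ∑ v ∈ Finset.univ.erase r, (subtreeSize par lev v : ℝ) ^ 2 := by
  have e : T.edgeFinset = (Finset.univ.erase r).image (fun v => s(v, par v)) := by
    ext e
    rw [SimpleGraph.mem_edgeFinset, h.mem_edgeSet_iff]
    simp
  rw [loss, e, Finset.sum_image]
  · refine Finset.sum_congr rfl fun v hv => ?_
    have hv : v ≠ r := by simpa using hv
    rw [one_mul, Finset.sum_const, nsmul_one, subtreeSize]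
    congr 3
    ext u
    simp [h.descendants_eq hv]
  · intro u hu v hv
    exact h.parEdge_injOn (by simpa using hu) (by simpa using hv)

open Classical in
theorem subtreeSize_eq [Fintype V] (h : IsParentMap T r par lev) (v : V) :
    subtreeSize par lev v =
      1 + ∑ c ∈ Finset.univ.filter (fun c => c ≠ r ∧ par c = v), subtreeSize par lev c := by
  have e : Finset.univ.filter (Below par lev v) = insert v
      ((Finset.univ.filter (fun c => c ≠ r ∧ par c = v)).biUnion
        fun c => Finset.univ.filter (Below par lev c)) := by
    ext u
    simp [h.below_iff_child (v := v) u, and_assoc]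
  rw [subtreeSize, e, Finset.card_insert_of_notMem, Finset.card_biUnion, add_comm]
  · rfl
  · intro c hc d hd hcd
    rw [Function.onFun, Finset.disjoint_left]
    intro u hu hu'
    simp only [Finset.coe_filter, Finset.mem_univ, true_and, Set.mem_ofPred_eq, Finset.mem_filter]
      at hc hd hu hu'
    have h1 := h.lev_par c hc.1
    have h2 := h.lev_par d hd.1
    rw [hc.2] at h1
    rw [hd.2] at h2
    exact hcd (below_unique hu hu' (by omega))
  · simp only [Finset.mem_biUnion, Finset.mem_filter, Finset.mem_univ, true_and, not_exists,
      not_and, and_imp]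
    intro c hc hcv hb
    have h1 := h.lev_par c hc
    rw [hcv] at h1
    have := hb.1
    omega

open Classical in
/-- Every vertex at distance at least `k` lies in a subtree at a vertex at distance `k`. -/
theorem card_le_sum_subtreeSize [Fintype V] (h : IsParentMap T r par lev) {g : V → ℕ}
    (hr : g r = 0) (hg : ∀ u, u ≠ r → g u ≤ g (par u) + 1) (k : ℕ) :
    (Finset.univ.filter fun u => k ≤ g u).card ≤
      ∑ v ∈ Finset.univ.filter (fun v => g v = k), subtreeSize par lev v := by
  refine le_trans (Finset.card_le_card ?_) Finset.card_biUnion_le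
  intro u hu
  simp only [Finset.mem_filter, Finset.mem_univ, true_and, Finset.mem_biUnion] at hu ⊢
  exact h.exists_below_level hr hg k u hu

open Classical in
-- Subtrees at the same level are disjoint, by `below_unique`.
theorem sum_subtreeSize_le [Fintype V] (k : ℕ) :
    ∑ v ∈ Finset.univ.filter (fun v => lev v = k), subtreeSize par lev v ≤
      (Finset.univ.filter fun u => k ≤ lev u).card := by
  simp only [subtreeSize]
  rw [← Finset.card_biUnion]
  · refine Finset.card_le_card fun u hu => ?_
    simp only [Finset.mem_filter, Finset.mem_univ, true_and, Finset.mem_biUnion] at hu ⊢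
    obtain ⟨v, rfl, hb⟩ := hu
    exact hb.1
  · intro c hc d hd hcd
    rw [Function.onFun, Finset.disjoint_left]
    intro u hu hu'
    simp only [Finset.coe_filter, Finset.mem_univ, true_and, Set.mem_ofPred_eq, Finset.mem_filter]
      at hc hd hu hu'
    exact hcd (below_unique hu hu' (by omega))

theorem neighborSet_eq (h : IsParentMap T r par lev) {v : V} (hv : v ≠ r) :
    T.neighborSet v = insert (par v) {c | c ≠ r ∧ par c = v} := by
  ext u
  rw [SimpleGraph.mem_neighborSet, h.adj]
  simp [hv, eq_comm, or_comm]

theorem ncard_neighborSet [Finite V] (h : IsParentMap T r par lev) {v : V} (hv : v ≠ r) :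
    (T.neighborSet v).ncard = {c | c ≠ r ∧ par c = v}.ncard + 1 := by
  rw [h.neighborSet_eq hv, Set.ncard_insert_of_notMem _ (Set.toFinite _)]
  rintro ⟨h1, h2⟩
  have := h.lev_par _ h1
  have := h.lev_par _ hv
  rw [h2] at *
  omega

end IsParentMap

/-- Every tree has a parent map. -/
theorem SimpleGraph.IsTree.exists_isParentMap [Finite V] {T : SimpleGraph V} (hT : T.IsTree)
    (r : V) : ∃ par, IsParentMap T r par (T.dist r) := by
  have hex : ∀ v, ∃ u, v ≠ r → T.Adj v u ∧ T.dist r u + 1 = T.dist r v := by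
    intro v
    by_cases hv : v = r
    · exact ⟨v, fun h => (h hv).elim⟩
    · obtain ⟨p, hp⟩ := hT.connected.exists_walk_length_eq_dist v r
      cases p with
      | nil => exact (hv rfl).elim
      | @cons _ u _ hadj p =>
        refine ⟨u, fun _ => ⟨hadj, ?_⟩⟩
        have h1 := SimpleGraph.dist_le p
        rw [SimpleGraph.Walk.length_cons, SimpleGraph.dist_comm] at hp
        rw [SimpleGraph.dist_comm] at h1
        have h2 := hT.dist_eq_dist_add_one_of_adj r hadj
        omega
  choose par hpar using hex
  refine ⟨par, ?_⟩
  set T' : SimpleGraph V :=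
    SimpleGraph.fromRel fun u v => v ≠ r ∧ par v = u with hT'
  have h' : IsParentMap T' r par (T.dist r) := by
    refine ⟨by simp, fun v hv => (hpar v hv).2, fun u v => ?_⟩
    rw [hT', SimpleGraph.fromRel_adj]
    refine ⟨fun h => h.2, fun h => ⟨?_, h⟩⟩
    rintro rfl
    obtain ⟨h1, h2⟩ : u ≠ r ∧ par u = u := by tauto
    have := (hpar u h1).1
    rw [h2] at this
    exact this.ne rfl
  have hle : T' ≤ T := by
    intro u v huv
    rcases (h'.adj u v).1 huv with ⟨h1, rfl⟩ | ⟨h1, rfl⟩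
    · exact (hpar v h1).1.symm
    · exact (hpar u h1).1
  -- The parent edges alone connect all vertices, and a tree is minimal among connected graphs.
  have e : T' = T := by
    refine le_antisymm hle ((SimpleGraph.isTree_iff_minimal_connected.1 hT).2 h'.connected hle)
  rw [← e] at h' ⊢
  rwa [e] at h' ⊢

end ParentMap

/-! ## Merging the two smallest subtrees -/

section Merge

/-- The place of `x 0 + x 1` in the list `x 2 ≤ x 3 ≤ … ≤ x (l - 1)`. -/
def insertionIndex (x : ℕ → ℕ) : ℕ → ℕ
  | 0 => 0
  | l + 1 => if 1 < l ∧ x l < x 0 + x 1 then l - 1 else insertionIndex x l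

/-- The recursion keeps the last index above 1 whose entry is less than `x 0 + x 1`, lowered by one;
without such an index the sum goes to the front. -/
theorem insertionIndex_eq_zero_or (x : ℕ → ℕ) (l : ℕ) :
    insertionIndex x l = 0 ∨
      (1 ≤ insertionIndex x l ∧ insertionIndex x l + 1 < l ∧
        x (insertionIndex x l + 1) < x 0 + x 1) := by
  induction l with
  | zero => exact Or.inl rfl
  | succ l ih =>
    rw [insertionIndex]
    split_ifs with h
    · right
      rw [show l - 1 + 1 = l by omega]
      exact ⟨by omega, by omega, h.2⟩
    · rcases ih with ih | ih
      · exact Or.inl ih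
      · exact Or.inr ⟨ih.1, by omega, ih.2.2⟩

theorem le_insertionIndex (x : ℕ → ℕ) {l p : ℕ} (hp : 1 < p) (hl : p < l)
    (h : x p < x 0 + x 1) : p ≤ insertionIndex x l + 1 := by
  induction l with
  | zero => omega
  | succ l ih =>
    rw [insertionIndex]
    split_ifs with h'
    · omega
    · rcases Nat.lt_succ_iff_lt_or_eq.1 hl with hl | rfl
      · exact ih hl
      · exact (h' ⟨hp, h⟩).elim

theorem insertionIndex_add_two_le (x : ℕ → ℕ) {l : ℕ} (hl : 2 ≤ l) :
    insertionIndex x l + 2 ≤ l := by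
  rcases insertionIndex_eq_zero_or x l with h | h <;> omega

/-- `x` is increasing on the indices less than `l`. -/
def SortedBelow (x : ℕ → ℕ) (l : ℕ) : Prop := ∀ i j, i ≤ j → j < l → x i ≤ x j

/-- In an increasing list the entries less than the sum form an initial segment. The offset 2 stands
for the removed entries `x 0` and `x 1`. -/
theorem SortedBelow.lt_iff {x : ℕ → ℕ} {l : ℕ} (hx : SortedBelow x l) {p : ℕ} (hp : 1 < p)
    (hl : p < l) : x p < x 0 + x 1 ↔ p < insertionIndex x l + 2 := by
  constructor
  · intro h
    have := le_insertionIndex x hp hl h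
    omega
  · intro h
    rcases insertionIndex_eq_zero_or x l with h' | h'
    · omega
    · exact (hx p _ (by omega) h'.2.1).trans_lt h'.2.2

/-- The list of sizes in the previous layer, if `x 0` and `x 1` are merged, and their sum is
inserted at place `q`. -/
def mergeStep (x : ℕ → ℕ) (q p : ℕ) : ℕ :=
  1 + (if p < q then x (p + 2) else if p = q then x 0 + x 1 else x (p + 1))

theorem SortedBelow.mergeStep {x : ℕ → ℕ} {l : ℕ} (hx : SortedBelow x l) :
    SortedBelow (mergeStep x (insertionIndex x l)) (l - 1) := by
  intro i j hij hj
  have h2 := insertionIndex_add_two_le x (l := l) (by omega)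
  have h3 := fun p => hx.lt_iff (p := p)
  set q := insertionIndex x l
  unfold _root_.mergeStep
  split_ifs with h4 h5 h6 h7 h8 h9 h10
  · have := hx (i + 2) (j + 2) (by omega) (by omega)
    omega
  · have := (h3 (i + 2) (by omega) (by omega)).2 (by omega)
    omega
  · have := hx (i + 2) (j + 1) (by omega) (by omega)
    omega
  · omega
  · omega
  · have := (h3 (j + 1) (by omega) (by omega)).not.2 (by omega)
    omega
  · omega
  · omega
  · have := hx (i + 1) (j + 1) (by omega) (by omega)
    omega

/-- The sizes of the subtrees in layer `a - 1 - t`, in increasing order; for `t = 0` they are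
`h + 1, …, h + a`. -/
def mergeSizes (a h : ℕ) : ℕ → ℕ → ℕ
  | 0 => fun p => h + 1 + p
  | t + 1 => mergeStep (mergeSizes a h t) (insertionIndex (mergeSizes a h t) (a - t))

/-- The rank in layer `a - 2 - t` of the vertex with two children. -/
def mergeIndex (a h t : ℕ) : ℕ := insertionIndex (mergeSizes a h t) (a - t)

theorem mergeIndex_add_two_le {a h t : ℕ} (ht : t + 2 ≤ a) : mergeIndex a h t + 2 ≤ a - t :=
  insertionIndex_add_two_le _ (by omega)

theorem sortedBelow_mergeSizes (a h t : ℕ) : SortedBelow (mergeSizes a h t) (a - t) := by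
  induction t with
  | zero => intro i j hij _; simp only [mergeSizes]; omega
  | succ t ih =>
    rw [mergeSizes, show a - (t + 1) = a - t - 1 by omega]
    exact ih.mergeStep

/-- The largest subtree has at most twice the size of the smallest one, or no merged subtree is
larger than all others. -/
theorem mergeSizes_balanced (a h t : ℕ) (ht : t < a) :
    (∀ p < a - t, mergeSizes a h t p ≤ 2 * mergeSizes a h t 0) ∨
      ∀ p < a - t, mergeSizes a h t p ≤ h + a + t := by
  induction t with
  | zero => right; intro p hp; simp only [mergeSizes]; omega
  | succ t ih =>
    have hs := sortedBelow_mergeSizes a h t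
    have hs' := sortedBelow_mergeSizes a h (t + 1)
    have h2 := insertionIndex_add_two_le (mergeSizes a h t) (l := a - t) (by omega)
    have h3 := fun p => hs.lt_iff (p := p)
    have ih := ih (by omega)
    simp only [mergeSizes]
    set x := mergeSizes a h t
    set q := insertionIndex x (a - t)
    have h01 := hs 0 1 (by omega) (by omega)
    -- All entries that survive the merge, and the sum itself, are at least `x 1`; the additional 1
    -- counts the parent.
    have hmin : x 1 + 1 ≤ mergeStep x q 0 := by
      unfold mergeStep
      split_ifs
      · have := hs 1 (0 + 2) (by omega) (by omega)
        omega
      · omega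
      · omega
    have hval : ∀ p < a - (t + 1), mergeStep x q p ≤ 1 + max (x (a - t - 1)) (x 0 + x 1) := by
      intro p hp
      unfold mergeStep
      split_ifs
      · have := hs (p + 2) (a - t - 1) (by omega) (by omega)
        omega
      · omega
      · have := hs (p + 1) (a - t - 1) (by omega) (by omega)
        omega
    -- If the merged subtree becomes the largest, the maximum is at most `1 + 2 * x 1`, less than
    -- twice the new minimum. Otherwise the maximum grows by at most one, and both alternatives
    -- survive, since the minimum grows by at least one and the bound `h + a + t` by one.
    rcases Nat.lt_or_ge (x (a - t - 1)) (x 0 + x 1) with hlt | hge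
    · left
      intro p hp
      have := hval p hp
      omega
    · rcases ih with ih | ih
      · left
        intro p hp
        have := hval p hp
        have := ih (a - t - 1) (by omega)
        omega
      · right
        intro p hp
        have := hval p hp
        have := ih (a - t - 1) (by omega)
        omega

end Merge

/-! ## The layers of a Min-Min tree -/

section Layers

/-- The ranks of the vertices in layer `k` of a grid with sides `a ≤ b`. -/
def ranks (a b k : ℕ) : Finset ℕ := Finset.Ico (k + 1 - b) (min (k + 1) a)

theorem mem_ranks {a b k ρ : ℕ} : ρ ∈ ranks a b k ↔ k + 1 ≤ ρ + b ∧ ρ < k + 1 ∧ ρ < a := by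
  rw [ranks, Finset.mem_Ico]
  omega

/-- The rank of the parent of the vertex with rank `ρ` in layer `k + 1`. -/
def parentRank (a b k ρ : ℕ) : ℕ :=
  if k + 1 < a then
    if ρ < 2 then mergeIndex a (b - a) (a - 2 - k)
    else if ρ - 2 < mergeIndex a (b - a) (a - 2 - k) then ρ - 2 else ρ - 1
  else ρ

/-- The position in layer `k` of the vertex with rank `ρ`. -/
def layerPos (a b : ℕ) : ℕ → ℕ → ℕ
  | 0 => fun _ => 0
  | k + 1 => fun ρ =>
    if k + 1 < a then
      if ρ < 2 then layerPos a b k (mergeIndex a (b - a) (a - 2 - k)) + ρ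
      else if layerPos a b k (mergeIndex a (b - a) (a - 2 - k)) < layerPos a b k (parentRank a b k ρ)
        then layerPos a b k (parentRank a b k ρ) + 1 else layerPos a b k (parentRank a b k ρ)
    else if k + 1 < b then layerPos a b k (parentRank a b k ρ)
    else if layerPos a b k (k + 1 - b) < layerPos a b k (parentRank a b k ρ)
      then layerPos a b k (parentRank a b k ρ) - 1 else layerPos a b k (parentRank a b k ρ)

/-- The size of the subtree at the vertex with rank `ρ` in layer `k`. -/
def rankSize (a b k ρ : ℕ) : ℕ :=
  if k + 1 < a then mergeSizes a (b - a) (a - 1 - k) ρ else b + ρ - k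

variable {a b : ℕ}

theorem mergeIndex_le {k : ℕ} (hk : k + 1 < a) : mergeIndex a (b - a) (a - 2 - k) ≤ k := by
  have := mergeIndex_add_two_le (a := a) (h := b - a) (t := a - 2 - k) (by omega)
  omega

/-- At the border `k = a - 1` the two formulas agree, because the initial sizes are `b - a + 1 + ρ`.
-/
theorem rankSize_of_le {k : ℕ} (hab : a ≤ b) (hk : k + 1 ≤ a) (ρ : ℕ) :
    rankSize a b k ρ = mergeSizes a (b - a) (a - 1 - k) ρ := by
  rw [rankSize]
  split_ifs
  · rfl
  · rw [show a - 1 - k = 0 by omega]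
    change _ = b - a + 1 + ρ
    omega

theorem parentRank_mem_ranks (hab : a ≤ b) {k ρ : ℕ} (h : ρ ∈ ranks a b (k + 1)) :
    parentRank a b k ρ ∈ ranks a b k := by
  rw [mem_ranks] at h ⊢
  unfold parentRank
  by_cases hk : k + 1 < a
  · have := mergeIndex_le (b := b) hk
    simp only [hk, if_true]
    split_ifs <;> omega
  · simp only [hk, if_false]
    omega

/-- The sizes of layer `k` arise from those of layer `k + 1` by removing the entries 0 and 1 and
inserting their sum at the merge index; `parentRank` follows each entry through this. -/
theorem filter_parentRank_of_lt (hab : a ≤ b) {k ρ : ℕ} (hk : k + 1 < a) (h : ρ ∈ ranks a b k) :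
    (ranks a b (k + 1)).filter (fun σ => parentRank a b k σ = ρ) =
      if ρ = mergeIndex a (b - a) (a - 2 - k) then {0, 1}
      else if ρ < mergeIndex a (b - a) (a - 2 - k) then {ρ + 2} else {ρ + 1} := by
  rw [mem_ranks] at h
  have := mergeIndex_le (b := b) hk
  ext σ
  rw [Finset.mem_filter, mem_ranks]
  unfold parentRank
  simp only [hk, if_true]
  set q := mergeIndex a (b - a) (a - 2 - k)
  split_ifs <;> simp only [Finset.mem_insert, Finset.mem_singleton] <;> omega

/-- From layer `a - 1` on, the rank is constant along a path. The rank `k + 1 - b` ends in layer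
`k`, where its size `b + ρ - k` is 1. -/
theorem filter_parentRank_of_le {k ρ : ℕ} (hk : a ≤ k + 1) (h : ρ ∈ ranks a b k) :
    (ranks a b (k + 1)).filter (fun σ => parentRank a b k σ = ρ) =
      if k + 2 ≤ ρ + b then {ρ} else ∅ := by
  rw [mem_ranks] at h
  ext σ
  rw [Finset.mem_filter, mem_ranks, parentRank, if_neg (by omega)]
  split_ifs
  · simp only [Finset.mem_singleton]
    omega
  · simp only [Finset.notMem_empty, iff_false]
    omega

/-- This is the recursion that subtree sizes satisfy, hence it identifies `rankSize` with them by
induction from the last layer inwards. -/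
theorem rankSize_eq (hab : a ≤ b) {k ρ : ℕ} (h : ρ ∈ ranks a b k) :
    rankSize a b k ρ =
      1 + ∑ σ ∈ (ranks a b (k + 1)).filter (fun σ => parentRank a b k σ = ρ),
        rankSize a b (k + 1) σ := by
  by_cases hk : k + 1 < a
  · rw [filter_parentRank_of_lt hab hk h, rankSize_of_le hab (by omega)]
    simp only [rankSize_of_le hab (show k + 1 + 1 ≤ a by omega)]
    -- Merge time runs towards the root: layer `k` has time `a - 1 - k`, and its merge index is
    -- computed from the sizes of layer `k + 1`, at time `a - 2 - k`.
    rw [show a - 1 - k = (a - 2 - k) + 1 by omega, show a - 1 - (k + 1) = a - 2 - k by omega,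
      mergeSizes, mergeStep, mergeIndex]
    split_ifs <;> first | omega | simp
  · rw [filter_parentRank_of_le (by omega) h]
    rw [mem_ranks] at h
    simp only [rankSize, if_neg hk, if_neg (show ¬ k + 1 + 1 < a by omega)]
    split_ifs
    · rw [Finset.sum_singleton]
      omega
    · rw [Finset.sum_empty]
      omega

theorem rankSize_le_rankSize (hab : a ≤ b) {k ρ σ : ℕ} (h : ρ ≤ σ) (hσ : σ ∈ ranks a b k) :
    rankSize a b k ρ ≤ rankSize a b k σ := by
  rw [mem_ranks] at hσ
  by_cases hk : k + 1 ≤ a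
  · rw [rankSize_of_le hab hk, rankSize_of_le hab hk]
    exact sortedBelow_mergeSizes a (b - a) (a - 1 - k) ρ σ h (by omega)
  · rw [rankSize, rankSize, if_neg (by omega), if_neg (by omega)]
    omega

/-- Up to layer `a - 1` this is `mergeSizes_balanced`, with `b + (a - 1 - k) ≤ 2 * b`. Beyond it the
sizes are `b - k + ρ` with `ρ < a`: if `k + a < b`, they lie between `b - k` and twice that, and
otherwise they are at most `b`. -/
theorem rankSize_balanced (hab : a ≤ b) (k : ℕ) :
    (∃ m, ∀ ρ ∈ ranks a b k, m ≤ rankSize a b k ρ ∧ rankSize a b k ρ ≤ 2 * m) ∨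
      ((k < a ∨ b ≤ k + a) ∧ ∀ ρ ∈ ranks a b k, rankSize a b k ρ ≤ 2 * b) := by
  by_cases hk : k + 1 ≤ a
  · simp only [rankSize_of_le hab hk]
    rcases mergeSizes_balanced a (b - a) (a - 1 - k) (by omega) with h | h
    · left
      refine ⟨mergeSizes a (b - a) (a - 1 - k) 0, fun ρ hρ => ?_⟩
      rw [mem_ranks] at hρ
      exact ⟨sortedBelow_mergeSizes a (b - a) (a - 1 - k) 0 ρ (by omega) (by omega),
        h ρ (by omega)⟩
    · right
      refine ⟨by omega, fun ρ hρ => ?_⟩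
      rw [mem_ranks] at hρ
      have := h ρ (by omega)
      omega
  · simp only [rankSize, if_neg (show ¬ k + 1 < a by omega)]
    by_cases hb : b ≤ k + a
    · right
      refine ⟨Or.inr hb, fun ρ hρ => ?_⟩
      rw [mem_ranks] at hρ
      omega
    · left
      refine ⟨b - k, fun ρ hρ => ?_⟩
      rw [mem_ranks] at hρ
      omega

/-- This and the next two lemmas provide the adjacency conditions of `IsLayered.adj` for the
growing, the constant and the shrinking layers. -/
theorem layerPos_succ_of_lt {k ρ : ℕ} (hk : k + 1 < a) :
    layerPos a b (k + 1) ρ = layerPos a b k (parentRank a b k ρ) ∨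
      layerPos a b (k + 1) ρ = layerPos a b k (parentRank a b k ρ) + 1 := by
  simp only [layerPos, if_pos hk]
  split_ifs with h1
  · rw [parentRank, if_pos hk, if_pos h1]
    omega
  · exact Or.inr rfl
  · exact Or.inl rfl

theorem layerPos_succ_of_mid {k ρ : ℕ} (ha : a ≤ k + 1) (hb : k + 1 < b) :
    layerPos a b (k + 1) ρ = layerPos a b k (parentRank a b k ρ) := by
  simp only [layerPos, if_neg (show ¬ k + 1 < a by omega), if_pos hb]

theorem layerPos_succ_of_le {k ρ : ℕ} (hab : a ≤ b) (hb : b ≤ k + 1) :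
    layerPos a b (k + 1) ρ = layerPos a b k (parentRank a b k ρ) ∨
      layerPos a b (k + 1) ρ + 1 = layerPos a b k (parentRank a b k ρ) := by
  simp only [layerPos, if_neg (show ¬ k + 1 < a by omega), if_neg (show ¬ k + 1 < b by omega)]
  split_ifs with h1
  · omega
  · exact Or.inl rfl

/-- Positions are assigned from the root outwards. In a growing layer the children of the merge
vertex take its position and the next one, and everything behind it moves up by one. In a shrinking
layer one vertex has no child, and everything behind it moves down by one. Hence no two ranks
collide, and the positions fill the layer, for any choice of the merge indices. -/
theorem layerPos_injOn_and_lt (hab : a ≤ b) (k : ℕ) :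
    Set.InjOn (layerPos a b k) (ranks a b k) ∧
      ∀ ρ ∈ ranks a b k, layerPos a b k ρ < (ranks a b k).card := by
  induction k with
  | zero =>
    constructor
    · intro ρ hρ σ hσ _
      rw [Finset.mem_coe, mem_ranks] at hρ hσ
      omega
    · intro ρ hρ
      exact Finset.card_pos.2 ⟨ρ, hρ⟩
  | succ k ih =>
    obtain ⟨hinj, hlt⟩ := ih
    have hpar := fun ρ hρ => parentRank_mem_ranks (k := k) (ρ := ρ) hab hρ
    have hinj' : ∀ ρ σ, ρ ∈ ranks a b k → σ ∈ ranks a b k →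
        layerPos a b k ρ = layerPos a b k σ → ρ = σ := fun ρ σ hρ hσ h => hinj hρ hσ h
    have hc : (ranks a b k).card = min (k + 1) a - (k + 1 - b) := by simp [ranks]
    have hc' : (ranks a b (k + 1)).card = min (k + 1 + 1) a - (k + 1 + 1 - b) := by simp [ranks]
    rw [hc] at hlt
    rw [hc']
    by_cases hk : k + 1 < a
    · have hq := mergeIndex_le (b := b) hk
      have hqm : mergeIndex a (b - a) (a - 2 - k) ∈ ranks a b k := by rw [mem_ranks]; omega
      have hz := hlt _ hqm
      have hpr : ∀ ρ, 2 ≤ ρ → parentRank a b k ρ =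
          if ρ - 2 < mergeIndex a (b - a) (a - 2 - k) then ρ - 2 else ρ - 1 := by
        intro ρ hρ
        rw [parentRank, if_pos hk, if_neg (by omega)]
      have hne : ∀ ρ, ρ ∈ ranks a b (k + 1) → 2 ≤ ρ → layerPos a b k (parentRank a b k ρ) ≠
          layerPos a b k (mergeIndex a (b - a) (a - 2 - k)) := by
        intro ρ hρ h2 e
        have := hinj' _ _ (hpar ρ hρ) hqm e
        rw [hpr ρ h2] at this
        split_ifs at this <;> omega
      have hne' : ∀ ρ σ, ρ ∈ ranks a b (k + 1) → 2 ≤ ρ → σ ∈ ranks a b (k + 1) → 2 ≤ σ → ρ ≠ σ →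
          layerPos a b k (parentRank a b k ρ) ≠ layerPos a b k (parentRank a b k σ) := by
        intro ρ σ hρ h2 hσ h2' hn e
        have := hinj' _ _ (hpar ρ hρ) (hpar σ hσ) e
        rw [hpr ρ h2, hpr σ h2'] at this
        split_ifs at this <;> omega
      simp only [layerPos, if_pos hk]
      constructor
      · intro ρ hρ σ hσ e
        rw [Finset.mem_coe] at hρ hσ
        have h1 := hne ρ hρ
        have h2 := hne σ hσ
        have h3 := hne' ρ σ hρ
        simp only at e
        by_contra hn
        split_ifs at e <;> first | omega | exact h3 (by omega) hσ (by omega) hn (by omega)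
      · intro ρ hρ
        have h1 := hlt _ (hpar ρ hρ)
        have h2 := hne ρ hρ
        rw [mem_ranks] at hρ
        split_ifs <;> omega
    · have hpr : ∀ ρ, parentRank a b k ρ = ρ := fun ρ => by rw [parentRank, if_neg hk]
      simp only [hpr] at hpar
      by_cases hb : k + 1 < b
      · simp only [layerPos, if_neg hk, if_pos hb, hpr]
        constructor
        · intro ρ hρ σ hσ e
          exact hinj' _ _ (hpar _ hρ) (hpar _ hσ) e
        · intro ρ hρ
          have := hlt _ (hpar _ hρ)
          omega
      · simp only [layerPos, if_neg hk, if_neg hb, hpr]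
        have ht : ∀ ρ ∈ ranks a b (k + 1), k + 1 - b ∈ ranks a b k := by
          intro ρ hρ
          rw [mem_ranks] at *
          omega
        have hne : ∀ ρ, ρ ∈ ranks a b (k + 1) →
            layerPos a b k ρ ≠ layerPos a b k (k + 1 - b) := by
          intro ρ hρ e
          have := hinj' _ _ (hpar ρ hρ) (ht ρ hρ) e
          rw [mem_ranks] at hρ
          omega
        constructor
        · intro ρ hρ σ hσ e
          rw [Finset.mem_coe] at hρ hσ
          have h1 := hne ρ hρ
          have h2 := hne σ hσ
          by_contra hn
          have h3 : layerPos a b k ρ ≠ layerPos a b k σ :=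
            fun e => hn (hinj' ρ σ (hpar ρ hρ) (hpar σ hσ) e)
          simp only at e
          split_ifs at e <;> omega
        · intro ρ hρ
          have h1 := hlt _ (hpar ρ hρ)
          have h2 := hne ρ hρ
          have h3 := hlt _ (ht ρ hρ)
          split_ifs <;> omega

end Layers

/-! ## Coordinates on a grid -/

section Grid

variable {V : Type*}

/-- Coordinates on an `n × m` grid with corner `r`. -/
structure GridCoord (n m : ℕ) (G : SimpleGraph V) (r : V) (I J : V → ℕ) : Prop where
  fst_lt : ∀ v, I v < n
  snd_lt : ∀ v, J v < m
  inj : ∀ u v, I u = I v → J u = J v → u = v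
  surj : ∀ i j, i < n → j < m → ∃ v, I v = i ∧ J v = j
  adj : ∀ u v, G.Adj u v ↔ (I u = I v ∧ (J u + 1 = J v ∨ J v + 1 = J u)) ∨
    (J u = J v ∧ (I u + 1 = I v ∨ I v + 1 = I u))
  fst_root : I r = 0
  snd_root : J r = 0

theorem IsGridWithCorner.exists_gridCoord {n m : ℕ} {G : SimpleGraph V} {r : V}
    (h : IsGridWithCorner n m G r) : ∃ I J, GridCoord n m G r I J := by
  obtain ⟨φ, h1, h2⟩ := h
  -- Each path is reflected, if necessary, so that the root gets coordinate 0.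
  have key : ∀ (n : ℕ) (x : Fin n), ((x : ℕ) = 0 ∨ (x : ℕ) + 1 = n) → ∃ f : Fin n → ℕ,
      (∀ y, f y < n) ∧ f x = 0 ∧ (∀ y z, f y = f z → y = z) ∧ (∀ i < n, ∃ y, f y = i) ∧
        ∀ y z, (f y + 1 = f z ∨ f z + 1 = f y) ↔ ((y : ℕ) + 1 = z ∨ (z : ℕ) + 1 = y) := by
    intro n x hx
    by_cases h0 : (x : ℕ) = 0
    · exact ⟨fun y => y, fun y => y.2, h0, fun y z e => Fin.ext e, fun i hi => ⟨⟨i, hi⟩, rfl⟩,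
        fun y z => Iff.rfl⟩
    · refine ⟨fun y => n - 1 - y, fun y => ?_, ?_, fun y z e => ?_, fun i hi => ?_, fun y z => ?_⟩
      · have := y.2
        simp only
        omega
      · simp only
        omega
      · have := y.2
        have := z.2
        simp only at e
        exact Fin.ext (by omega)
      · exact ⟨⟨n - 1 - i, by omega⟩, by simp only; omega⟩
      · have := y.2
        have := z.2
        simp only
        omega
  obtain ⟨f, f1, f2, f3, f4, f5⟩ := key n _ h1
  obtain ⟨g, g1, g2, g3, g4, g5⟩ := key m _ h2
  refine ⟨fun v => f (φ v).1, fun v => g (φ v).2, fun v => f1 _, fun v => g1 _, ?_, ?_, ?_, f2, g2⟩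
  · intro u v e1 e2
    exact φ.injective (Prod.ext (f3 _ _ e1) (g3 _ _ e2))
  · intro i j hi hj
    obtain ⟨y, rfl⟩ := f4 i hi
    obtain ⟨z, rfl⟩ := g4 j hj
    exact ⟨φ.symm (y, z), by simp, by simp⟩
  · intro u v
    rw [← φ.map_adj_iff, SimpleGraph.boxProd_adj, SimpleGraph.pathGraph_adj,
      SimpleGraph.pathGraph_adj, f5, g5]
    have e1 : f (φ u).1 = f (φ v).1 ↔ (φ u).1 = (φ v).1 := ⟨f3 _ _, fun e => by rw [e]⟩
    have e2 : g (φ u).2 = g (φ v).2 ↔ (φ u).2 = (φ v).2 := ⟨g3 _ _, fun e => by rw [e]⟩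
    rw [e1, e2]
    tauto

namespace GridCoord

variable {n m : ℕ} {G : SimpleGraph V} {r : V} {I J : V → ℕ}

theorem swap (h : GridCoord n m G r I J) : GridCoord m n G r J I where
  fst_lt := h.snd_lt
  snd_lt := h.fst_lt
  inj u v e1 e2 := h.inj u v e2 e1
  surj i j hi hj := by
    obtain ⟨v, e1, e2⟩ := h.surj j i hj hi
    exact ⟨v, e2, e1⟩
  adj u v := by rw [h.adj, or_comm]
  fst_root := h.snd_root
  snd_root := h.fst_root

theorem exists_walk (h : GridCoord n m G r I J) (u v : V) :
    ∃ p : G.Walk u v, p.length = (I u - I v) + (I v - I u) + ((J u - J v) + (J v - J u)) := by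
  induction hk : (I u - I v) + (I v - I u) + ((J u - J v) + (J v - J u)) generalizing u with
  | zero =>
    obtain rfl := h.inj u v (by omega) (by omega)
    exact ⟨.nil, rfl⟩
  | succ k ih =>
    have h1 := h.fst_lt u
    have h2 := h.fst_lt v
    have h3 := h.snd_lt u
    have h4 := h.snd_lt v
    have : ∃ w, G.Adj u w ∧
        (I w - I v) + (I v - I w) + ((J w - J v) + (J v - J w)) = k := by
      rcases lt_trichotomy (I u) (I v) with hlt | e | hlt
      · obtain ⟨w, e1, e2⟩ := h.surj (I u + 1) (J u) (by omega) (by omega)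
        exact ⟨w, (h.adj _ _).2 (by omega), by omega⟩
      · rcases lt_trichotomy (J u) (J v) with hlt | e | hlt
        · obtain ⟨w, e1, e2⟩ := h.surj (I u) (J u + 1) (by omega) (by omega)
          exact ⟨w, (h.adj _ _).2 (by omega), by omega⟩
        · omega
        · obtain ⟨w, e1, e2⟩ := h.surj (I u) (J u - 1) (by omega) (by omega)
          exact ⟨w, (h.adj _ _).2 (by omega), by omega⟩
      · obtain ⟨w, e1, e2⟩ := h.surj (I u - 1) (J u) (by omega) (by omega)
        exact ⟨w, (h.adj _ _).2 (by omega), by omega⟩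
    obtain ⟨w, hw, hk'⟩ := this
    obtain ⟨p, hp⟩ := ih w hk'
    exact ⟨.cons hw p, by rw [SimpleGraph.Walk.length_cons, hp]⟩

theorem le_length (h : GridCoord n m G r I J) {u v : V} (p : G.Walk u v) :
    (I u - I v) + (I v - I u) + ((J u - J v) + (J v - J u)) ≤ p.length := by
  induction p with
  | nil => simp
  | cons hadj p ih =>
    rw [SimpleGraph.Walk.length_cons]
    have := (h.adj _ _).1 hadj
    omega

theorem connected (h : GridCoord n m G r I J) : G.Connected := by
  rw [SimpleGraph.connected_iff_exists_forall_reachable]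
  exact ⟨r, fun u => (h.exists_walk r u).choose.reachable⟩

theorem dist_eq (h : GridCoord n m G r I J) (u v : V) :
    G.dist u v = (I u - I v) + (I v - I u) + ((J u - J v) + (J v - J u)) := by
  apply le_antisymm
  · obtain ⟨p, hp⟩ := h.exists_walk u v
    rw [← hp]
    exact SimpleGraph.dist_le p
  · obtain ⟨p, hp⟩ := h.connected.exists_walk_length_eq_dist u v
    rw [← hp]
    exact h.le_length p

theorem dist_root (h : GridCoord n m G r I J) (v : V) : G.dist r v = I v + J v := by
  rw [h.dist_eq, h.fst_root, h.snd_root]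
  omega

theorem card_eq [Fintype V] (h : GridCoord n m G r I J) : Fintype.card V = n * m := by
  rw [Fintype.card_of_bijective (f := fun v => ((⟨I v, h.fst_lt v⟩ : Fin n), (⟨J v, h.snd_lt v⟩ : Fin m)))]
  · simp
  · constructor
    · intro u v e
      simp only [Prod.mk.injEq, Fin.mk.injEq] at e
      exact h.inj u v e.1 e.2
    · rintro ⟨i, j⟩
      obtain ⟨v, e1, e2⟩ := h.surj i j i.2 j.2
      exact ⟨v, Prod.ext (Fin.ext e1) (Fin.ext e2)⟩

/-- The number of the vertices at distance `k` from the corner `r` that are closer than `v` to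
the corner with coordinates `(n - 1, 0)`. -/
theorem card_before [Fintype V] (h : GridCoord n m G r I J) {c : V} (hc : I c + 1 = n)
    (hc' : J c = 0) (v : V) :
    (Finset.univ.filter fun u => G.dist r u = G.dist r v ∧ G.dist c u < G.dist c v).card =
      J v - (I v + J v + 1 - n) := by
  rw [← Nat.card_Ico]
  simp only [h.dist_root, h.dist_eq c]
  have hv := h.fst_lt v
  have hv' := h.snd_lt v
  -- In layer `k` the distance from `c` is `n - 1 - k + 2 * J`, so closer to `c` means smaller `J`,
  -- and `k + 1 - n` is a lower bound for `J` there.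
  refine Finset.card_bij (fun u _ => J u) ?_ ?_ ?_
  · intro u hu
    have := h.fst_lt u
    simp only [Finset.mem_filter, Finset.mem_univ, true_and] at hu
    rw [Finset.mem_Ico]
    omega
  · intro u hu w hw e
    simp only [Finset.mem_filter, Finset.mem_univ, true_and] at hu hw
    exact h.inj u w (by omega) e
  · intro j hj
    rw [Finset.mem_Ico] at hj
    obtain ⟨u, e1, e2⟩ := h.surj (I v + J v - j) j (by omega) (by omega)
    have := h.fst_lt u
    refine ⟨u, ?_, e2⟩
    simp only [Finset.mem_filter, Finset.mem_univ, true_and]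
    omega

theorem card_layer_le [Fintype V] (h : GridCoord n m G r I J) (k : ℕ) :
    (Finset.univ.filter fun v => G.dist r v = k).card ≤ k + 1 := by
  rw [← Finset.card_range (k + 1)]
  simp only [h.dist_root]
  refine Finset.card_le_card_of_injOn J ?_ ?_
  · intro v hv
    simp only [Finset.coe_filter, Finset.mem_univ, true_and, Set.mem_ofPred_eq] at hv
    simp only [Finset.coe_range, Set.mem_Iio]
    omega
  · intro u hu v hv e
    simp only [Finset.coe_filter, Finset.mem_univ, true_and, Set.mem_ofPred_eq] at hu hv
    exact h.inj u v (by omega) e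

theorem mul_le_card [Fintype V] (h : GridCoord n m G r I J) (k : ℕ) :
    n * (m - k) ≤ (Finset.univ.filter fun v => k ≤ G.dist r v).card := by
  have : n * (m - k) = (Finset.range n ×ˢ Finset.Ico k m).card := by simp
  rw [this]
  refine Finset.card_le_card_of_surjOn (fun v => (I v, J v)) ?_
  rintro ⟨i, j⟩ hij
  simp only [Finset.coe_product, Finset.coe_range, Finset.coe_Ico, Set.mem_prod, Set.mem_Iio,
    Set.mem_Ico] at hij
  obtain ⟨v, e1, e2⟩ := h.surj i j hij.1 hij.2.2
  refine ⟨v, ?_, by simp [e1, e2]⟩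
  simp only [Finset.coe_filter, Finset.mem_univ, true_and, Set.mem_ofPred_eq, h.dist_root]
  omega

end GridCoord

/-- Positions in the layers of a grid with sides `a ≤ b`: the function `pos` numbers the vertices
of each layer, in their order along the diagonal. -/
structure IsLayered (a b : ℕ) (G : SimpleGraph V) (r : V) (pos : V → ℕ) : Prop where
  pos_lt : ∀ v, pos v < (ranks a b (G.dist r v)).card
  inj : ∀ u v, G.dist r u = G.dist r v → pos u = pos v → u = v
  surj : ∀ k p, p < (ranks a b k).card → ∃ v, G.dist r v = k ∧ pos v = p
  adj : ∀ u v, G.dist r v = G.dist r u + 1 →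
    (G.dist r v < a → pos v = pos u ∨ pos v = pos u + 1) →
    (a ≤ G.dist r v → G.dist r v < b → pos v = pos u) →
    (b ≤ G.dist r v → pos v = pos u ∨ pos v + 1 = pos u) → G.Adj u v

theorem card_ranks (a b k : ℕ) : (ranks a b k).card = min (k + 1) a - (k + 1 - b) := by
  simp [ranks]

/-- The position is `J` minus its smallest value in the layer. With this normalisation positions
stay constant across the middle layers, whichever side is longer. -/
theorem GridCoord.isLayered {n m : ℕ} {G : SimpleGraph V} {r : V} {I J : V → ℕ}
    (h : GridCoord n m G r I J) :
    IsLayered (min n m) (max n m) G r fun v => J v - (I v + J v + 1 - n) where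
  pos_lt v := by
    have := h.fst_lt v
    have := h.snd_lt v
    rw [card_ranks, h.dist_root]
    omega
  inj u v e1 e2 := by
    have := h.fst_lt u
    have := h.fst_lt v
    rw [h.dist_root, h.dist_root] at e1
    exact h.inj u v (by omega) (by omega)
  surj k p hp := by
    rw [card_ranks] at hp
    obtain ⟨v, e1, e2⟩ := h.surj (k - (p + (k + 1 - n))) (p + (k + 1 - n)) (by omega) (by omega)
    refine ⟨v, ?_, ?_⟩
    · rw [h.dist_root]
      omega
    · omega
  adj u v e h1 h2 h3 := by
    have := h.fst_lt u
    have := h.fst_lt v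
    have := h.snd_lt u
    have := h.snd_lt v
    simp only [h.dist_root] at *
    rw [h.adj]
    omega

end Grid

/-! ## The Min-Min tree of a grid -/

section MinMin

variable {V : Type*}

/-- The tree `T` joins a vertex to the vertex in the previous layer that has the rank of its
parent. -/
structure IsRanking (a b : ℕ) (G : SimpleGraph V) (r : V) (rank : V → ℕ) (T : SimpleGraph V) :
    Prop where
  le : a ≤ b
  connected : G.Connected
  mem_ranks : ∀ v, rank v ∈ ranks a b (G.dist r v)
  inj : ∀ u v, G.dist r u = G.dist r v → rank u = rank v → u = v
  surj : ∀ k, ∀ ρ ∈ ranks a b k, ∃ v, G.dist r v = k ∧ rank v = ρ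
  adj_iff : ∀ u v, T.Adj u v ↔
    (G.dist r v = G.dist r u + 1 ∧ rank u = parentRank a b (G.dist r u) (rank v)) ∨
    (G.dist r u = G.dist r v + 1 ∧ rank v = parentRank a b (G.dist r v) (rank u))
  adj_of : ∀ u v, G.dist r v = G.dist r u + 1 →
    rank u = parentRank a b (G.dist r u) (rank v) → G.Adj u v

/-- An injection between finite sets of equal size is surjective. -/
theorem IsLayered.exists_rank {a b : ℕ} {G : SimpleGraph V} {r : V} {pos : V → ℕ}
    (h : IsLayered a b G r pos) (hab : a ≤ b) (v : V) :
    ∃ ρ ∈ ranks a b (G.dist r v), layerPos a b (G.dist r v) ρ = pos v := by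
  obtain ⟨h1, h2⟩ := layerPos_injOn_and_lt hab (G.dist r v)
  have := Finset.surj_on_of_inj_on_of_card_le (s := ranks a b (G.dist r v))
    (t := Finset.range (ranks a b (G.dist r v)).card) (fun ρ _ => layerPos a b (G.dist r v) ρ)
    (fun ρ hρ => Finset.mem_range.2 (h2 ρ hρ)) (fun ρ σ hρ hσ e => h1 hρ hσ e) (by simp) (pos v)
    (Finset.mem_range.2 (h.pos_lt v))
  obtain ⟨ρ, hρ, e⟩ := this
  exact ⟨ρ, hρ, e.symm⟩

theorem IsLayered.isRanking {a b : ℕ} {G T : SimpleGraph V} {r : V} {pos rank : V → ℕ}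
    (h : IsLayered a b G r pos) (hG : G.Connected) (hab : a ≤ b)
    (hmem : ∀ v, rank v ∈ ranks a b (G.dist r v))
    (hpos : ∀ v, layerPos a b (G.dist r v) (rank v) = pos v)
    (hT : ∀ u v, T.Adj u v ↔
      (G.dist r v = G.dist r u + 1 ∧ rank u = parentRank a b (G.dist r u) (rank v)) ∨
      (G.dist r u = G.dist r v + 1 ∧ rank v = parentRank a b (G.dist r v) (rank u))) :
    IsRanking a b G r rank T where
  le := hab
  connected := hG
  mem_ranks := hmem
  inj u v e1 e2 := h.inj u v e1 (by rw [← hpos, ← hpos, e1, e2])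
  surj k ρ hρ := by
    obtain ⟨h1, h2⟩ := layerPos_injOn_and_lt hab k
    obtain ⟨v, rfl, e2⟩ := h.surj k _ (h2 ρ hρ)
    exact ⟨v, rfl, h1 (hmem v) hρ (by rw [hpos, e2])⟩
  adj_iff := hT
  adj_of u v e1 e2 := by
    refine h.adj u v e1 (fun h1 => ?_) (fun h1 h2 => ?_) (fun h1 => ?_) <;>
      rw [← hpos, ← hpos, e1, e2]
    · exact layerPos_succ_of_lt (by omega)
    · exact layerPos_succ_of_mid (by omega) (by omega)
    · exact layerPos_succ_of_le hab (by omega)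

namespace IsRanking

variable {a b : ℕ} {G T : SimpleGraph V} {r : V} {rank : V → ℕ}

theorem exists_par (h : IsRanking a b G r rank T) : ∃ par : V → V, IsParentMap T r par (G.dist r) ∧
    ∀ v, v ≠ r → rank (par v) = parentRank a b (G.dist r (par v)) (rank v) := by
  have hex : ∀ v, ∃ u, v ≠ r → G.dist r u + 1 = G.dist r v ∧
      rank u = parentRank a b (G.dist r u) (rank v) := by
    intro v
    by_cases hv : v = r
    · exact ⟨v, fun h => (h hv).elim⟩
    · have := h.connected.pos_dist_of_ne (Ne.symm hv)
      have hm := h.mem_ranks v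
      rw [show G.dist r v = G.dist r v - 1 + 1 by omega] at hm
      obtain ⟨u, e1, e2⟩ := h.surj _ _ (parentRank_mem_ranks h.le hm)
      exact ⟨u, fun _ => ⟨by omega, by rw [e2, e1]⟩⟩
  choose par hpar using hex
  have key : ∀ u v, (G.dist r v = G.dist r u + 1 ∧
      rank u = parentRank a b (G.dist r u) (rank v)) ↔ v ≠ r ∧ par v = u := by
    intro u v
    constructor
    · rintro ⟨e1, e2⟩
      have hv : v ≠ r := by
        rintro rfl
        simp at e1
      obtain ⟨e3, e4⟩ := hpar v hv
      have e5 : G.dist r (par v) = G.dist r u := by omega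
      exact ⟨hv, h.inj _ _ e5 (by rw [e2, e4, e5])⟩
    · rintro ⟨hv, rfl⟩
      exact ⟨(hpar v hv).1.symm, (hpar v hv).2⟩
  exact ⟨par, ⟨by simp, fun v hv => (hpar v hv).1, fun u v => by rw [h.adj_iff, key, key]⟩,
    fun v hv => (hpar v hv).2⟩

theorem spanning [Finite V] (h : IsRanking a b G r rank T) : IsSpanningTree G T := by
  obtain ⟨par, hpar, -⟩ := h.exists_par
  refine ⟨fun u v huv => ?_, hpar.isTree⟩
  rcases (h.adj_iff u v).1 huv with ⟨h1, h2⟩ | ⟨h1, h2⟩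
  · exact h.adj_of u v h1 h2
  · exact (h.adj_of v u h1 h2).symm

variable {par : V → V}

theorem mem_children_iff (h : IsRanking a b G r rank T) (hpar : IsParentMap T r par (G.dist r))
    (hrank : ∀ v, v ≠ r → rank (par v) = parentRank a b (G.dist r (par v)) (rank v)) {c v : V} :
    (c ≠ r ∧ par c = v) ↔
      G.dist r c = G.dist r v + 1 ∧ rank v = parentRank a b (G.dist r v) (rank c) := by
  constructor
  · rintro ⟨hc, rfl⟩
    exact ⟨(hpar.lev_par c hc).symm, hrank c hc⟩
  · rintro ⟨e1, e2⟩
    have hc : c ≠ r := by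
      rintro rfl
      simp at e1
    have e3 := hpar.lev_par c hc
    have e4 : G.dist r (par c) = G.dist r v := by omega
    exact ⟨hc, h.inj _ _ e4 (by rw [hrank c hc, e2, e4])⟩

open Classical in
theorem sum_children [Fintype V] (h : IsRanking a b G r rank T)
    (hpar : IsParentMap T r par (G.dist r))
    (hrank : ∀ v, v ≠ r → rank (par v) = parentRank a b (G.dist r (par v)) (rank v)) (v : V)
    (f : ℕ → ℕ) :
    ∑ c ∈ Finset.univ.filter (fun c => c ≠ r ∧ par c = v), f (rank c) =
      ∑ σ ∈ (ranks a b (G.dist r v + 1)).filter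
        (fun σ => parentRank a b (G.dist r v) σ = rank v), f σ := by
  refine Finset.sum_nbij rank ?_ ?_ ?_ fun _ _ => rfl
  · intro c hc
    rw [Finset.mem_filter, h.mem_children_iff hpar hrank] at hc
    rw [Finset.mem_filter, ← hc.2.1]
    exact ⟨h.mem_ranks c, hc.2.2.symm⟩
  · intro c hc d hd e
    rw [Finset.mem_coe, Finset.mem_filter, h.mem_children_iff hpar hrank] at hc hd
    exact h.inj _ _ (by rw [hc.2.1, hd.2.1]) e
  · intro σ hσ
    rw [Finset.mem_coe, Finset.mem_filter] at hσ
    obtain ⟨c, e1, e2⟩ := h.surj _ _ hσ.1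
    refine ⟨c, ?_, e2⟩
    rw [Finset.mem_coe, Finset.mem_filter, h.mem_children_iff hpar hrank, e2]
    exact ⟨Finset.mem_univ _, e1, hσ.2.symm⟩

theorem dist_lt (h : IsRanking a b G r rank T) (v : V) : G.dist r v + 1 < a + b := by
  have := _root_.mem_ranks.1 (h.mem_ranks v)
  omega

theorem subtreeSize_eq_rankSize [Fintype V] (h : IsRanking a b G r rank T)
    (hpar : IsParentMap T r par (G.dist r))
    (hrank : ∀ v, v ≠ r → rank (par v) = parentRank a b (G.dist r (par v)) (rank v)) (v : V) :
    subtreeSize par (G.dist r) v = rankSize a b (G.dist r v) (rank v) := by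
  classical
  induction hk : a + b - G.dist r v using Nat.strong_induction_on generalizing v with
  | _ k ih =>
    rw [hpar.subtreeSize_eq, rankSize_eq h.le (h.mem_ranks v), ← h.sum_children hpar hrank]
    congr 1
    refine Finset.sum_congr rfl fun c hc => ?_
    rw [Finset.mem_filter, h.mem_children_iff hpar hrank] at hc
    have := h.dist_lt c
    rw [ih _ (by omega) c rfl, hc.2.1]

theorem ncard_children [Fintype V] (h : IsRanking a b G r rank T)
    (hpar : IsParentMap T r par (G.dist r))
    (hrank : ∀ v, v ≠ r → rank (par v) = parentRank a b (G.dist r (par v)) (rank v)) (v : V) :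
    {c | c ≠ r ∧ par c = v}.ncard = ((ranks a b (G.dist r v + 1)).filter
        (fun σ => parentRank a b (G.dist r v) σ = rank v)).card := by
  classical
  have := h.sum_children hpar hrank v fun _ => 1
  simp only [Finset.sum_const, smul_eq_mul, mul_one] at this
  rw [← this, ← Set.ncard_coe_finset]
  congr 1
  ext
  simp

/-- From layer `a - 1` on, `parentRank` is the identity, so a vertex has at most one child. -/
theorem exists_path [Finite V] (h : IsRanking a b G r rank T)
    (hpar : IsParentMap T r par (G.dist r))
    (hrank : ∀ v, v ≠ r → rank (par v) = parentRank a b (G.dist r (par v)) (rank v)) (v : V)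
    (hv : a ≤ G.dist r v + 1) :
    ∃ (w : V) (p : T.Walk v w), p.IsPath ∧ ∀ u, u ∈ p.support ↔ Below par (G.dist r) v u := by
  induction hk : a + b - G.dist r v using Nat.strong_induction_on generalizing v with
  | _ k ih =>
    by_cases hc : ∃ c, c ≠ r ∧ par c = v
    · obtain ⟨c, hc⟩ := hc
      have hc' := (h.mem_children_iff hpar hrank).1 hc
      have := h.dist_lt c
      obtain ⟨w, p, hp, hs⟩ := ih _ (by omega) c (by omega) rfl
      have hadj : T.Adj v c := (hpar.adj _ _).2 (Or.inl hc)
      refine ⟨w, .cons hadj p, ?_, fun u => ?_⟩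
      · rw [SimpleGraph.Walk.cons_isPath_iff]
        refine ⟨hp, fun hmem => ?_⟩
        have := ((hs v).1 hmem).1
        omega
      · rw [SimpleGraph.Walk.support_cons, List.mem_cons, hs, hpar.below_iff_child (v := v)]
        refine or_congr Iff.rfl ⟨fun hb => ⟨c, hc.1, hc.2, hb⟩, ?_⟩
        rintro ⟨d, hd, hdv, hb⟩
        have hd' := (h.mem_children_iff hpar hrank).1 ⟨hd, hdv⟩
        have e : d = c := by
          refine h.inj _ _ (by omega) ?_
          have h1 := hc'.2
          have h2 := hd'.2
          rw [parentRank, if_neg (by omega)] at h1 h2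
          omega
        exact e ▸ hb
    · refine ⟨v, .nil, by simp, fun u => ?_⟩
      rw [hpar.below_iff_child]
      constructor
      · intro hu
        left
        simpa using hu
      · rintro (rfl | ⟨c, h1, h2, -⟩)
        · simp
        · exact (hc ⟨c, h1, h2⟩).elim

theorem isMinMinTree [Fintype V] (h : IsRanking a b G r rank T) : IsMinMinTree a b G r T := by
  obtain ⟨par, hpar, hrank⟩ := h.exists_par
  have hsize : ∀ v, (subtreeAt T r v).ncard = rankSize a b (G.dist r v) (rank v) := by
    intro v
    rw [hpar.subtreeAt_eq, IsParentMap.ncard_below, h.subtreeSize_eq_rankSize hpar hrank]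
  refine ⟨h.spanning, fun v => hpar.dist_root v, ?_, ?_, ?_⟩
  · intro v h1 _
    obtain ⟨w, p, hp, hs⟩ := h.exists_path hpar hrank v h1
    refine ⟨w, p, hp, ?_⟩
    rw [hpar.subtreeAt_eq]
    ext u
    exact hs u
  · intro u v h1 h2 e hne
    rw [hsize, hsize, rankSize, rankSize, e, if_neg (by omega), if_neg (by omega)]
    have h3 : rank u ≠ rank v := fun e' => hne (h.inj _ _ e e')
    omega
  · intro k hk hka
    have hka' : k + 1 < a := by omega
    have hq := mergeIndex_le (b := b) hka'
    have hab := h.le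
    obtain ⟨z, hz, hzr⟩ := h.surj k (mergeIndex a (b - a) (a - 2 - k)) (by
      rw [_root_.mem_ranks]; omega)
    -- Sizes increase with the rank, so the ranks 0 and 1 belong to two smallest subtrees of the
    -- layer.
    obtain ⟨x, hx, hxr⟩ := h.surj (k + 1) 0 (by rw [_root_.mem_ranks]; omega)
    obtain ⟨y, hy, hyr⟩ := h.surj (k + 1) 1 (by rw [_root_.mem_ranks]; omega)
    have hroot : ∀ v, G.dist r v = k → v ≠ r := by
      rintro v hv rfl
      rw [SimpleGraph.dist_self] at hv
      omega
    have hadj : ∀ c, G.dist r c = k + 1 → rank c < 2 → T.Adj z c := by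
      intro c hc hcr
      rw [h.adj_iff]
      left
      rw [hz, hc, hzr, parentRank, if_pos hka', if_pos hcr]
      exact ⟨rfl, rfl⟩
    have hmin : ∀ c, G.dist r c = k + 1 → rank c < 2 → ∀ w, G.dist r w = k + 1 → w ≠ x → w ≠ y →
        (subtreeAt T r c).ncard ≤ (subtreeAt T r w).ncard := by
      intro c hc hcr w hw hwx hwy
      rw [hsize, hsize, hc, hw]
      have h0 : rank w ≠ 0 := fun e => hwx (h.inj _ _ (by rw [hw, hx]) (by rw [e, hxr]))
      have h1 : rank w ≠ 1 := fun e => hwy (h.inj _ _ (by rw [hw, hy]) (by rw [e, hyr]))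
      exact rankSize_le_rankSize hab (by omega) (hw ▸ h.mem_ranks w)
    refine ⟨z, hz, ?_, fun v hv hvz => ?_, x, y, ?_, hx, hy, hadj x hx (by omega),
      hadj y hy (by omega), fun w hw hwx hwy => ⟨hmin x hx (by omega) w hw hwx hwy,
        hmin y hy (by omega) w hw hwx hwy⟩⟩
    · rw [hpar.ncard_neighborSet (hroot z hz), h.ncard_children hpar hrank, hz,
        filter_parentRank_of_lt hab hka' (hz ▸ h.mem_ranks z), if_pos hzr]
      rfl
    · have hne : rank v ≠ mergeIndex a (b - a) (a - 2 - k) :=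
        fun e => hvz (h.inj _ _ (by rw [hv, hz]) (by rw [e, hzr]))
      rw [hpar.ncard_neighborSet (hroot v hv), h.ncard_children hpar hrank, hv,
        filter_parentRank_of_lt hab hka' (hv ▸ h.mem_ranks v), if_neg hne]
      split_ifs <;> rfl
    · rintro rfl
      omega

end IsRanking

end MinMin

/-! ## The loss of the Min-Min tree -/

section Approximation

/-- Reverse Cauchy–Schwarz: for values in `[m, M]` the constant is `(m + M) ^ 2 / (4 * m * M)`,
which is `9/8` for `M = 2 * m`. It comes from `(f i - m) * (2 * m - f i) ≥ 0`. -/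
theorem card_mul_sum_sq_le {ι : Type*} (s : Finset ι) (f : ι → ℝ) (m : ℝ)
    (hf : ∀ i ∈ s, m ≤ f i ∧ f i ≤ 2 * m) :
    (s.card : ℝ) * ∑ i ∈ s, f i ^ 2 ≤ 9 / 8 * (∑ i ∈ s, f i) ^ 2 := by
  have h1 : ∑ i ∈ s, f i ^ 2 ≤ 3 * m * ∑ i ∈ s, f i - 2 * m ^ 2 * s.card := by
    have : ∑ i ∈ s, f i ^ 2 ≤ ∑ i ∈ s, (3 * m * f i - 2 * m ^ 2) := by
      refine Finset.sum_le_sum fun i hi => ?_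
      have := mul_nonneg (sub_nonneg.2 (hf i hi).1) (sub_nonneg.2 (hf i hi).2)
      linarith
    rw [Finset.sum_sub_distrib, ← Finset.mul_sum, Finset.sum_const, nsmul_eq_mul] at this
    linarith
  have h2 := mul_le_mul_of_nonneg_left h1 (Nat.cast_nonneg (α := ℝ) s.card)
  -- The two sides differ by one eighth of this square.
  linarith [sq_nonneg (3 * ∑ i ∈ s, f i - 4 * m * s.card)]

variable {V : Type*} [Fintype V] {G : SimpleGraph V} {r : V}

/-- The vertices at distance `k` from the root. -/
noncomputable def layer (G : SimpleGraph V) (r : V) (k : ℕ) : Finset V :=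
  Finset.univ.filter fun v => G.dist r v = k

/-- The vertices at distance at least `k` from the root. -/
noncomputable def outside (G : SimpleGraph V) (r : V) (k : ℕ) : Finset V :=
  Finset.univ.filter fun v => k ≤ G.dist r v

theorem sum_layers_le (f : V → ℝ) (hf : ∀ v, 0 ≤ f v) (K : ℕ) [DecidableEq V] :
    ∑ k ∈ Finset.range K, ∑ v ∈ layer G r (k + 1), f v ≤ ∑ v ∈ Finset.univ.erase r, f v := by
  rw [← Finset.sum_biUnion]
  · refine Finset.sum_le_sum_of_subset_of_nonneg ?_ fun v _ _ => hf v
    intro v hv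
    simp only [Finset.mem_biUnion, layer, Finset.mem_filter, Finset.mem_univ, true_and] at hv
    obtain ⟨k, -, hk⟩ := hv
    rw [Finset.mem_erase]
    refine ⟨?_, Finset.mem_univ _⟩
    rintro rfl
    simp at hk
  · intro i _ j _ hij
    rw [Function.onFun, Finset.disjoint_left]
    intro v hv hv'
    simp only [layer, Finset.mem_filter, Finset.mem_univ, true_and] at hv hv'
    omega

theorem sum_erase_eq_sum_layers (hG : G.Connected) (f : V → ℝ) (K : ℕ) [DecidableEq V]
    (hK : ∀ v, G.dist r v ≤ K) :
    ∑ v ∈ Finset.univ.erase r, f v = ∑ k ∈ Finset.range K, ∑ v ∈ layer G r (k + 1), f v := by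
  rw [← Finset.sum_biUnion]
  · congr 1
    ext v
    simp only [Finset.mem_biUnion, layer, Finset.mem_filter, Finset.mem_univ, true_and,
      Finset.mem_erase, and_true, Finset.mem_range]
    constructor
    · intro hv
      have h1 := hG.pos_dist_of_ne (Ne.symm hv)
      have h2 := hK v
      exact ⟨G.dist r v - 1, by omega, by omega⟩
    · rintro ⟨k, -, hk⟩ rfl
      simp at hk
  · intro i _ j _ hij
    rw [Function.onFun, Finset.disjoint_left]
    intro v hv hv'
    simp only [layer, Finset.mem_filter, Finset.mem_univ, true_and] at hv hv'
    omega

/-- The flow through each layer is at least the number of the vertices behind it. -/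
theorem sum_le_loss {T : SimpleGraph V} (hT : IsSpanningTree G T) (K : ℕ) :
    ∑ k ∈ Finset.range K, ((outside G r (k + 1)).card : ℝ) ^ 2 / (layer G r (k + 1)).card ≤
      loss T r (fun _ => 1) (fun _ => 1) := by
  classical
  obtain ⟨par, hpar⟩ := hT.2.exists_isParentMap r
  rw [hpar.loss_eq]
  refine le_trans (Finset.sum_le_sum fun k _ => ?_) (sum_layers_le (G := G) _ (fun v => sq_nonneg _) K)
  have h1 : (outside G r (k + 1)).card ≤ ∑ v ∈ layer G r (k + 1), subtreeSize par (T.dist r) v := by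
    refine hpar.card_le_sum_subtreeSize (g := G.dist r) (by simp) (fun u hu => ?_) (k + 1)
    have hadj := hT.1 (hpar.adj_par hu)
    -- Edges of `T` are edges of `G`, so the distance in `G` changes by at most one along them.
    have := hadj.symm.diff_dist_adj (u := r)
    omega
  have h2 : ((outside G r (k + 1)).card : ℝ) ≤
      ∑ v ∈ layer G r (k + 1), (subtreeSize par (T.dist r) v : ℝ) := by exact_mod_cast h1
  have h3 := sq_sum_le_card_mul_sum_sq (s := layer G r (k + 1))
    (f := fun v => (subtreeSize par (T.dist r) v : ℝ))
  -- Beyond the last layer the denominator is 0, and the term is 0 by the convention for division.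
  refine div_le_of_le_mul₀ (Nat.cast_nonneg _) (Finset.sum_nonneg fun _ _ => sq_nonneg _) ?_
  rw [mul_comm]
  exact (pow_le_pow_left₀ (Nat.cast_nonneg _) h2 2).trans h3

theorem loss_nonneg (T : SimpleGraph V) : 0 ≤ loss T r (fun _ => 1) (fun _ => 1) := by
  unfold loss
  positivity

/-- In a layer that need not be balanced, the sum of squares is at most the largest size, `2 * b`,
times the sum of the sizes, which is at most the number of vertices. -/
theorem IsRanking.sum_layer_le {a b : ℕ} {T : SimpleGraph V} {rank : V → ℕ}
    (h : IsRanking a b G r rank T) {par : V → V} (hpar : IsParentMap T r par (G.dist r))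
    (hrank : ∀ v, v ≠ r → rank (par v) = parentRank a b (G.dist r (par v)) (rank v)) (k : ℕ) :
    ∑ v ∈ layer G r k, (subtreeSize par (G.dist r) v : ℝ) ^ 2 ≤
      9 / 8 * (((outside G r k).card : ℝ) ^ 2 / (layer G r k).card) +
        if k < a ∨ b ≤ k + a then 2 * b * (Fintype.card V : ℝ) else 0 := by
  have hS : (∑ v ∈ layer G r k, (subtreeSize par (G.dist r) v : ℝ)) ≤ (outside G r k).card := by
    exact_mod_cast IsParentMap.sum_subtreeSize_le (par := par) (lev := G.dist r) k
  have hnn : 0 ≤ ∑ v ∈ layer G r k, (subtreeSize par (G.dist r) v : ℝ) :=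
    Finset.sum_nonneg fun _ _ => Nat.cast_nonneg _
  have hsz : ∀ v ∈ layer G r k, rank v ∈ ranks a b k ∧
      subtreeSize par (G.dist r) v = rankSize a b k (rank v) := by
    intro v hv
    rw [layer, Finset.mem_filter] at hv
    rw [h.subtreeSize_eq_rankSize hpar hrank, hv.2]
    exact ⟨hv.2 ▸ h.mem_ranks v, rfl⟩
  rcases rankSize_balanced h.le k with ⟨m, hm⟩ | ⟨hk, hm⟩
  · have h1 := card_mul_sum_sq_le (layer G r k) (fun v => (subtreeSize par (G.dist r) v : ℝ)) m (by
      intro v hv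
      obtain ⟨h1, h2⟩ := hsz v hv
      rw [h2]
      exact ⟨by exact_mod_cast (hm _ h1).1, by exact_mod_cast (hm _ h1).2⟩)
    have h2 : ∑ v ∈ layer G r k, (subtreeSize par (G.dist r) v : ℝ) ^ 2 ≤
        9 / 8 * (((outside G r k).card : ℝ) ^ 2 / (layer G r k).card) := by
      rcases Finset.eq_empty_or_nonempty (layer G r k) with he | hne
      · rw [he]
        simp
      · have hc : (0 : ℝ) < (layer G r k).card := by exact_mod_cast Finset.card_pos.2 hne
        rw [← mul_div_assoc, le_div_iff₀ hc, mul_comm]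
        refine h1.trans ?_
        have := pow_le_pow_left₀ hnn hS 2
        linarith
    refine h2.trans (le_add_of_nonneg_right ?_)
    positivity
  · rw [if_pos hk]
    have h1 : ∑ v ∈ layer G r k, (subtreeSize par (G.dist r) v : ℝ) ^ 2 ≤
        ∑ v ∈ layer G r k, 2 * (b : ℝ) * (subtreeSize par (G.dist r) v : ℝ) := by
      refine Finset.sum_le_sum fun v hv => ?_
      obtain ⟨h1, h2⟩ := hsz v hv
      rw [sq]
      refine mul_le_mul_of_nonneg_right ?_ (Nat.cast_nonneg _)
      rw [h2]
      exact_mod_cast hm _ h1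
    rw [← Finset.mul_sum] at h1
    have h2 : ((outside G r k).card : ℝ) ≤ Fintype.card V := by
      exact_mod_cast Finset.card_le_univ _
    have h3 : 2 * (b : ℝ) * ∑ v ∈ layer G r k, (subtreeSize par (G.dist r) v : ℝ) ≤
        2 * b * (Fintype.card V : ℝ) :=
      mul_le_mul_of_nonneg_left (hS.trans h2) (by positivity)
    have h4 : 0 ≤ 9 / 8 * (((outside G r k).card : ℝ) ^ 2 / (layer G r k).card) := by positivity
    linarith

/-- The index `k` stands for layer `k + 1`; the two alternatives are the growing layers and the last
ones. -/
theorem card_filter_unbalanced_le (a b : ℕ) :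
    ((Finset.range (a + b)).filter fun k => k + 1 < a ∨ b ≤ k + 1 + a).card ≤ 3 * a + 1 := by
  have : (Finset.range (a + b)).filter (fun k => k + 1 < a ∨ b ≤ k + 1 + a) ⊆
      Finset.range (a - 1) ∪ Finset.Ico (b - a - 1) (a + b) := by
    intro k hk
    simp only [Finset.mem_filter, Finset.mem_range, Finset.mem_union, Finset.mem_Ico] at *
    omega
  refine (Finset.card_le_card this).trans ((Finset.card_union_le _ _).trans ?_)
  rw [Finset.card_range, Nat.card_Ico]
  omega

theorem IsRanking.loss_le {a b : ℕ} {T : SimpleGraph V} {rank : V → ℕ}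
    (h : IsRanking a b G r rank T) {T' : SimpleGraph V} (hT' : IsSpanningTree G T') :
    loss T r (fun _ => 1) (fun _ => 1) ≤ 9 / 8 * loss T' r (fun _ => 1) (fun _ => 1) +
      (3 * a + 1) * (2 * b * (Fintype.card V : ℝ)) := by
  classical
  obtain ⟨par, hpar, hrank⟩ := h.exists_par
  have hd : ∀ v, G.dist r v ≤ a + b := fun v => by have := h.dist_lt v; omega
  have h1 := sum_le_loss (r := r) hT' (a + b)
  rw [hpar.loss_eq, sum_erase_eq_sum_layers h.connected _ (a + b) hd]
  refine (Finset.sum_le_sum fun k _ => h.sum_layer_le hpar hrank (k + 1)).trans ?_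
  rw [Finset.sum_add_distrib, ← Finset.mul_sum]
  refine add_le_add (mul_le_mul_of_nonneg_left h1 (by norm_num)) ?_
  rw [← Finset.sum_filter, Finset.sum_const, nsmul_eq_mul]
  refine mul_le_mul_of_nonneg_right ?_ (by positivity)
  exact_mod_cast card_filter_unbalanced_le a b

/-! ### Logarithmic growth of the optimal loss, and the error term -/

/-- A lower bound for the growth of the loss. -/
noncomputable def layerSum (s : ℕ) : ℝ := ∑ k ∈ Finset.range (s / 2), 1 / ((k : ℝ) + 2)

theorem layerSum_mono : Monotone layerSum := by
  intro s t hst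
  refine Finset.sum_le_sum_of_subset_of_nonneg ?_ fun k _ _ => by positivity
  exact Finset.range_mono (Nat.div_le_div_right hst)

theorem half_le_layerSum {s : ℕ} (hs : 2 ≤ s) : 1 / 2 ≤ layerSum s := by
  refine le_trans ?_ (layerSum_mono hs)
  simp [layerSum]

theorem tendsto_layerSum : Tendsto layerSum atTop atTop := by
  have h1 := Real.tendsto_sum_range_one_div_nat_succ_atTop
  have h2 : Tendsto (fun K => ∑ k ∈ Finset.range K, 1 / ((k : ℝ) + 2)) atTop atTop := by
    -- The sum is the harmonic sum with one more term, without its first term 1.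
    have h3 := tendsto_atTop_add_const_right _ (-1 : ℝ) (h1.comp (tendsto_add_atTop_nat 1))
    refine h3.congr fun K => ?_
    simp only [Function.comp]
    rw [Finset.sum_range_succ']
    simp only [Nat.cast_add, Nat.cast_one, Nat.cast_zero]
    norm_num [add_assoc]
  exact h2.comp (Nat.tendsto_div_const_atTop (by norm_num))

/-- For `k + 1 ≤ m / 2` at least half of the vertices are at distance at least `k + 1`, while that
layer has at most `k + 2` vertices. -/
theorem GridCoord.mul_layerSum_le {n m : ℕ} {I J : V → ℕ} (h : GridCoord n m G r I J)
    {T : SimpleGraph V} (hT : IsSpanningTree G T) :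
    ((n : ℝ) * m) ^ 2 / 4 * layerSum m ≤ loss T r (fun _ => 1) (fun _ => 1) := by
  refine le_trans ?_ (sum_le_loss hT (m / 2))
  rw [layerSum, Finset.mul_sum]
  refine Finset.sum_le_sum fun k hk => ?_
  rw [Finset.mem_range] at hk
  have hn := h.fst_lt r
  have h1 := h.mul_le_card (k + 1)
  have h2 := h.card_layer_le (k + 1)
  obtain ⟨v, e1, e2⟩ := h.surj 0 (k + 1) (by omega) (by omega)
  have h3 : 0 < (layer G r (k + 1)).card := Finset.card_pos.2 ⟨v, by
    rw [layer, Finset.mem_filter, h.dist_root]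
    exact ⟨Finset.mem_univ _, by omega⟩⟩
  have h4 : ((layer G r (k + 1)).card : ℝ) ≤ k + 2 := by
    have : (layer G r (k + 1)).card ≤ k + 2 := h2
    exact_mod_cast this
  have h5 : (n : ℝ) * m / 2 ≤ (outside G r (k + 1)).card := by
    have h6 : n * m ≤ 2 * (outside G r (k + 1)).card := by
      refine le_trans ?_ (Nat.mul_le_mul_left 2 h1)
      rw [mul_left_comm]
      exact Nat.mul_le_mul_left n (by omega)
    have h7 : (n : ℝ) * m ≤ 2 * (outside G r (k + 1)).card := by exact_mod_cast h6
    linarith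
  have h8 : ((n : ℝ) * m) ^ 2 / 4 * (1 / (k + 2)) = ((n : ℝ) * m / 2) ^ 2 / (k + 2) := by ring
  rw [h8]
  have h9 : (0 : ℝ) < (layer G r (k + 1)).card := by exact_mod_cast h3
  exact div_le_div₀ (by positivity) (pow_le_pow_left₀ (by positivity) h5 2) h9 h4

/-- The error term of the approximation. -/
noncomputable def approxError (N : ℕ) : ℝ := 32 / max (1 / 2) (layerSum (Nat.sqrt N))

theorem tendsto_approxError : Tendsto approxError atTop (𝓝 0) := by
  refine Tendsto.const_div_atTop ?_ _
  refine tendsto_atTop_mono (fun N => le_max_right _ _) ?_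
  refine tendsto_layerSum.comp (tendsto_atTop.2 fun s => ?_)
  filter_upwards [eventually_ge_atTop (s * s)] with N hN
  exact Nat.le_sqrt.2 hN

theorem approxError_nonneg (N : ℕ) : 0 ≤ approxError N := by
  unfold approxError
  positivity

theorem GridCoord.loss_le {n m : ℕ} {I J : V → ℕ} (h : GridCoord n m G r I J)
    {T : SimpleGraph V} {rank : V → ℕ} (hT : IsRanking (min n m) (max n m) G r rank T)
    {T' : SimpleGraph V} (hT' : IsSpanningTree G T') :
    loss T r (fun _ => 1) (fun _ => 1) ≤
      (9 / 8 + approxError (Fintype.card V)) * loss T' r (fun _ => 1) (fun _ => 1) := by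
  wlog hnm : n ≤ m generalizing n m I J
  · rw [min_comm, max_comm] at hT
    exact this h.swap hT (by omega)
  rw [min_eq_left hnm, max_eq_right hnm] at hT
  have hn := h.fst_lt r
  have h0 := loss_nonneg (r := r) T'
  have hcard := h.card_eq
  -- A single vertex has loss 0; it is treated apart because `layerSum 1 = 0`.
  by_cases hm : m = 1
  · obtain ⟨par, hpar, -⟩ := hT.exists_par
    have hn1 : n = 1 := by omega
    have hsub : ∀ u v : V, u = v := by
      rw [← Fintype.card_le_one_iff, hcard, hm, hn1]
    rw [hpar.loss_eq]
    refine (Finset.sum_eq_zero fun v hv => ?_).trans_le ?_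
    · classical exact (Finset.ne_of_mem_erase hv (hsub v r)).elim
    exact mul_nonneg (add_nonneg (by norm_num) (approxError_nonneg _)) h0
  · have h1 := hT.loss_le hT'
    have h2 := h.mul_layerSum_le hT'
    have h3 : max (1 / 2) (layerSum (Nat.sqrt (Fintype.card V))) ≤ layerSum m := by
      refine max_le (half_le_layerSum (by omega)) (layerSum_mono ?_)
      rw [hcard]
      exact (Nat.sqrt_le_sqrt (Nat.mul_le_mul_right m hnm)).trans (Nat.sqrt_eq m).le
    have hpos : 0 < max (1 / 2) (layerSum (Nat.sqrt (Fintype.card V))) :=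
      lt_of_lt_of_le (by norm_num) (le_max_left _ _)
    -- The 32 in `approxError` is the 8 of the additive error times the 4 in the lower bound;
    -- `Nat.sqrt` enters because the longer side is at least the square root of the number of
    -- vertices.
    have h4 : ((n : ℝ) * m) ^ 2 * 8 ≤ approxError (Fintype.card V) *
        loss T' r (fun _ => 1) (fun _ => 1) := by
      rw [approxError, div_mul_eq_mul_div, le_div_iff₀ hpos]
      have := mul_le_mul_of_nonneg_left h3 (show (0 : ℝ) ≤ ((n : ℝ) * m) ^ 2 * 8 by positivity)
      linarith
    have h5 : (3 * (n : ℝ) + 1) * (2 * m * (Fintype.card V : ℝ)) ≤ ((n : ℝ) * m) ^ 2 * 8 := by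
      rw [hcard, Nat.cast_mul]
      have h6 : (1 : ℝ) ≤ n := by exact_mod_cast (show 1 ≤ n by omega)
      have h7 : (3 * (n : ℝ) + 1) ≤ 4 * n := by linarith
      have h8 := mul_le_mul_of_nonneg_right h7
        (show (0 : ℝ) ≤ 2 * m * ((n : ℝ) * m) by positivity)
      linarith
    linarith

end Approximation

/-! ## Parts of the program -/

namespace Ram

namespace Cmd

/-- If `e < f` then `c`. -/
def ifLess (e f : Expr) (c : Cmd) : Cmd := .ifLt e f c .skip

/-- If `e = f` then `c`. -/
def ifEq (e f : Expr) (c : Cmd) : Cmd :=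
  .ifLt (.add (.sub e f) (.sub f e)) (.const 1) c .skip

theorem run_ifLess (e f : Expr) (c : Cmd) (l : ℕ) (ρ : ℕ → ℕ) (A : ℕ → ℕ → ℕ) :
    (ifLess e f c).run l ρ A = if e.eval ⟨ρ, A⟩ < f.eval ⟨ρ, A⟩ then c.run l ρ A else A := rfl

/-- Both truncated differences vanish exactly if the values agree. -/
theorem run_ifEq (e f : Expr) (c : Cmd) (l : ℕ) (ρ : ℕ → ℕ) (A : ℕ → ℕ → ℕ) :
    (ifEq e f c).run l ρ A = if e.eval ⟨ρ, A⟩ = f.eval ⟨ρ, A⟩ then c.run l ρ A else A := by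
  simp only [ifEq, run, Expr.eval]
  congr 1
  exact propext (by omega)

@[simp] theorem writes_ifLess (e f : Expr) (c : Cmd) : (ifLess e f c).writes = c.writes := by
  simp [ifLess, writes]

@[simp] theorem writes_ifEq (e f : Expr) (c : Cmd) : (ifEq e f c).writes = c.writes := by
  simp [ifEq, writes]

/-- The entry `(e, f)` of the `N × N` matrix in array `a`, if array `2` holds the multiples
of `N`. -/
def _root_.Ram.Expr.entry (a : ℕ) (e f : Expr) : Expr := .cell a (.add (.cell 2 e) f)

/-- Writes the multiples of `N` into array `2`. -/
def multiples : Cmd :=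
  .loop (.write 2 (.add (.reg 2) (.const 1)) (.add (.cell 2 (.reg 2)) (.reg 0)))

theorem run_multiples {ρ : ℕ → ℕ} {A : ℕ → ℕ → ℕ} (h0 : A 2 0 = 0) :
    ∀ u ≤ ρ 0, multiples.run 0 ρ A 2 u = u * ρ 0 := by
  refine run_loop (fun k B => ∀ u ≤ k, B 2 u = u * ρ 0) ?_ ?_
  · intro u hu
    obtain rfl : u = 0 := by omega
    simp [h0]
  · intro k B _ _ ih u hu
    simp only [run, Expr.eval, Function.update_self, zero_add, Function.update_apply]
    norm_num
    split_ifs with h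
    · rw [ih k le_rfl, h]
      ring
    · exact ih u (by omega)

/-! ### Shortest distances by repeated relaxation of all edges -/

/-- Computes the distances from the vertex `src`. -/
def distances (a : ℕ) (src : Expr) : Cmd :=
  .seq (.loop (.write a (.reg 2) (.reg 0)))
    (.seq (.write a src (.const 0))
      (.loop (.loop (.loop
        (ifLess (.const 0) (.entry 0 (.reg 3) (.reg 4))
          (ifLess (.add (.cell a (.reg 3)) (.const 1)) (.cell a (.reg 4))
            (.write a (.reg 4) (.add (.cell a (.reg 3)) (.const 1)))))))))

theorem writes_distances (a : ℕ) (src : Expr) : (distances a src).writes = [a, a, a] := by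
  simp [distances, writes]

section Graph

variable {N : ℕ} {G : SimpleGraph (Fin N)} {r : Fin N} {ρ : ℕ → ℕ} {A : ℕ → ℕ → ℕ}

/-- The arrays `0` and `2` hold the adjacency matrix and the multiples of `N`. -/
structure HoldsGraph (G : SimpleGraph (Fin N)) (A : ℕ → ℕ → ℕ) : Prop where
  adj : ∀ u v : Fin N, 0 < A 0 (u * N + v) ↔ G.Adj u v
  mul : ∀ u ≤ N, A 2 u = u * N

theorem HoldsGraph.congr (h : HoldsGraph G A) {B : ℕ → ℕ → ℕ} (h0 : B 0 = A 0) (h2 : B 2 = A 2) :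
    HoldsGraph G B := ⟨by rw [h0]; exact h.adj, by rw [h2]; exact h.mul⟩

/-- The Bellman–Ford method: entries never fall below the true distances, and after `t` rounds they
are exact up to distance `t`. The initial value `N` serves as infinity, since all distances are less
than `N`. -/
theorem run_distances (hG : G.Connected) (hρ : ρ 0 = N) (hA : HoldsGraph G A) {a : ℕ} (ha0 : a ≠ 0)
    (ha2 : a ≠ 2) {src : Expr} {s : Fin N}
    (hs : ∀ B : ℕ → ℕ → ℕ, (∀ i, i ≠ a → B i = A i) → src.eval ⟨ρ, B⟩ = s) (v : Fin N) :
    (distances a src).run 0 ρ A a v = G.dist s v := by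
  have hlt : ∀ v, G.dist s v < N := by
    intro v
    obtain ⟨p, hp, hl⟩ := hG.exists_path_of_dist s v
    have := hp.length_lt
    rwa [hl, Fintype.card_fin] at this
  have hinit : ∀ v < ρ 0, (loop (.write a (.reg 2) (.reg 0))).run 0 ρ A a v = N := by
    refine run_loop (fun k B => ∀ v < k, B a v = N) (by simp) ?_
    intro k B _ _ ih v hv
    simp only [run, Expr.eval, Function.update_self, zero_add, Function.update_apply]
    norm_num
    split_ifs with h
    · exact hρ
    · exact ih v (by omega)
  have hfr := fun i (hi : i ≠ a) =>
    run_of_notMem_writes (loop (.write a (.reg 2) (.reg 0))) 0 ρ A i (by simpa [writes] using hi)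
  set A₁ := (loop (.write a (.reg 2) (.reg 0))).run 0 ρ A with hA₁
  set A₂ := (Cmd.write a src (.const 0)).run 0 ρ A₁ with hA₂
  have hA₂v : ∀ v : Fin N, A₂ a v = if v = s then 0 else N := by
    intro v
    rw [hA₂]
    simp only [run, Expr.eval, Function.update_self, hs A₁ hfr, Function.update_apply,
      Fin.ext_iff]
    split_ifs
    · rfl
    · exact hinit v (by rw [hρ]; exact v.2)
  have hA₂' : ∀ i, i ≠ a → A₂ i = A i := by
    intro i hi
    rw [hA₂, run_of_notMem_writes _ _ _ _ _ (by simpa [writes] using hi)]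
    exact hfr i hi
  have hg : ∀ B : ℕ → ℕ → ℕ, (∀ i, i ≠ a → B i = A i) → HoldsGraph G B := fun B hB =>
    hA.congr (hB 0 ha0.symm) (hB 2 ha2.symm)
  set Good : ℕ → (ℕ → ℕ → ℕ) → Prop := fun t B =>
    (∀ i, i ≠ a → B i = A i) ∧ (∀ v : Fin N, G.dist s v ≤ B a v) ∧
      ∀ v : Fin N, G.dist s v ≤ t → B a v ≤ G.dist s v with hGood
  -- `Done` records that the edge has been relaxed in the current round; it persists because entries
  -- only decrease.
  set Done : ℕ → (ℕ → ℕ → ℕ) → Fin N → Fin N → Prop := fun t B u v =>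
    G.Adj u v → G.dist s u ≤ t → B a v ≤ G.dist s u + 1 with hDone
  have main : Good (ρ 0) ((loop (.loop (.loop
        (ifLess (.const 0) (.entry 0 (.reg 3) (.reg 4))
          (ifLess (.add (.cell a (.reg 3)) (.const 1)) (.cell a (.reg 4))
            (.write a (.reg 4) (.add (.cell a (.reg 3)) (.const 1)))))))).run 0 ρ A₂) := by
    refine run_loop Good ⟨hA₂', fun v => ?_, fun v hv => ?_⟩ ?_
    · rw [hA₂v]
      split_ifs with h
      · simp [h]
      · exact (hlt v).le
    · have : s = v := by
        rw [← hG.dist_eq_zero_iff]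
        omega
      rw [hA₂v, if_pos this.symm]
      omega
    · intro t B _ _ hB
      have key := run_loop (c := .loop
        (ifLess (.const 0) (.entry 0 (.reg 3) (.reg 4))
          (ifLess (.add (.cell a (.reg 3)) (.const 1)) (.cell a (.reg 4))
            (.write a (.reg 4) (.add (.cell a (.reg 3)) (.const 1)))))) (l := 1)
        (ρ := Function.update ρ 2 t) (A := B)
        (fun k C => Good t C ∧ ∀ u v : Fin N, (u : ℕ) < k → Done t C u v)
        ⟨hB, fun u v hu => by omega⟩ ?_
      · rw [Function.update_of_ne (by norm_num), hρ] at key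
        obtain ⟨⟨k1, k2, k3⟩, k4⟩ := key
        refine ⟨k1, k2, fun v hv => ?_⟩
        rcases Nat.lt_or_ge (G.dist s v) (t + 1) with hlt | hge
        · exact k3 v (by omega)
        -- A vertex at distance `t + 1` has a neighbour at distance `t`, whose entry was exact when
        -- their edge was relaxed.
        · obtain ⟨p, hp⟩ := hG.exists_walk_length_eq_dist v s
          cases p with
          | nil =>
            rw [SimpleGraph.dist_self] at hge
            omega
          | @cons _ u _ hadj p =>
            rw [SimpleGraph.Walk.length_cons, SimpleGraph.dist_comm] at hp
            have h1 := SimpleGraph.dist_le p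
            rw [SimpleGraph.dist_comm] at h1
            have := k4 u v u.2 hadj.symm (by omega)
            change _ ≤ _
            refine this.trans ?_
            omega
      · intro k B hk _ hB
        rw [Function.update_of_ne (by norm_num), hρ] at hk
        have key := run_loop (c :=
          (ifLess (.const 0) (.entry 0 (.reg 3) (.reg 4))
            (ifLess (.add (.cell a (.reg 3)) (.const 1)) (.cell a (.reg 4))
              (.write a (.reg 4) (.add (.cell a (.reg 3)) (.const 1)))))) (l := 2)
          (ρ := Function.update (Function.update ρ 2 t) 3 k) (A := B)
          (fun j C => Good t C ∧ (∀ u v : Fin N, (u : ℕ) < k → Done t C u v) ∧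
            ∀ v : Fin N, (v : ℕ) < j → Done t C ⟨k, hk⟩ v)
          ⟨hB.1, hB.2, fun v hv => by omega⟩ ?_
        · rw [Function.update_of_ne (by norm_num), Function.update_of_ne (by norm_num), hρ] at key
          obtain ⟨k1, k2, k3⟩ := key
          refine ⟨k1, fun u v hu => ?_⟩
          rcases Nat.lt_succ_iff_lt_or_eq.1 hu with hu | hu
          · exact k2 u v hu
          · obtain rfl : u = ⟨k, hk⟩ := Fin.ext hu
            exact k3 v v.2
        · intro j B hj _ hB
          rw [Function.update_of_ne (by norm_num), Function.update_of_ne (by norm_num), hρ] at hj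
          obtain ⟨⟨b1, b2, b3⟩, b4, b5⟩ := hB
          have hgB := hg B b1
          set u : Fin N := ⟨k, hk⟩
          set w : Fin N := ⟨j, hj⟩ with hw
          have hrun : (ifLess (.const 0) (.entry 0 (.reg 3) (.reg 4))
            (ifLess (.add (.cell a (.reg 3)) (.const 1)) (.cell a (.reg 4))
              (.write a (.reg 4) (.add (.cell a (.reg 3)) (.const 1))))).run (2 + 1)
                (Function.update (Function.update (Function.update ρ 2 t) 3 k) (2 + 2) j) B =
              if 0 < B 0 (u * N + w) ∧ B a u + 1 < B a w then
                Function.update B a (Function.update (B a) w (B a u + 1)) else B := by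
            simp only [run_ifLess, Expr.entry, Expr.eval, run]
            norm_num
            rw [hgB.mul k hk.le, ite_and]
          rw [hrun]
          have hmono : ∀ v : Fin N, (if 0 < B 0 (u * N + w) ∧ B a u + 1 < B a w then
                Function.update B a (Function.update (B a) w (B a u + 1)) else B) a v ≤ B a v := by
            intro v
            split_ifs with h
            · rw [Function.update_self, Function.update_apply]
              split_ifs with h'
              · rw [h']
                exact h.2.le
              · exact le_rfl
            · exact le_rfl
          refine ⟨⟨fun i hi => ?_, fun v => ?_, fun v hv => (hmono v).trans (b3 v hv)⟩,
            fun x v hx h1 h2 => (hmono v).trans (b4 x v hx h1 h2), fun v hv h1 h2 => ?_⟩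
          · split_ifs
            · rw [Function.update_of_ne hi, b1 i hi]
            · exact b1 i hi
          · split_ifs with h
            · rw [Function.update_self, Function.update_apply]
              split_ifs with h'
              · obtain rfl : v = w := Fin.ext h'
                have h3 := b2 u
                have h4 := ((hgB.adj u w).1 h.1).diff_dist_adj (u := s)
                omega
              · exact b2 v
            · exact b2 v
          · rcases Nat.lt_succ_iff_lt_or_eq.1 hv with hv | hv
            · exact (hmono v).trans (b5 v hv h1 h2)
            · obtain rfl : v = w := Fin.ext hv
              have h3 := b3 u h2
              split_ifs with h
              · rw [Function.update_self, Function.update_self]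
                omega
              · rw [not_and, not_lt] at h
                have := h ((hgB.adj u w).2 h1)
                omega
  obtain ⟨-, m1, m2⟩ := main
  refine le_antisymm (m2 v ?_) (m1 v)
  rw [hρ]
  exact (hlt v).le

end Graph

/-- The invariant rule for two nested loops, where the body `(k, j)` establishes `D k j` and
preserves what the earlier bodies have established. -/
theorem run_loop_loop {c : Cmd} {ρ : ℕ → ℕ} {A : ℕ → ℕ → ℕ} (I : (ℕ → ℕ → ℕ) → Prop)
    (D : ℕ → ℕ → (ℕ → ℕ → ℕ) → Prop) (h0 : I A)
    (hstep : ∀ k j B, k < ρ 0 → j < ρ 0 → (∀ a, a ∉ c.writes → B a = A a) → I B →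
      (∀ k' j', j' < ρ 0 → k' < k ∨ (k' = k ∧ j' < j) → D k' j' B) →
      I (c.run 2 (Function.update (Function.update ρ 2 k) 3 j) B) ∧
      D k j (c.run 2 (Function.update (Function.update ρ 2 k) 3 j) B) ∧
      ∀ k' j', j' < ρ 0 → k' < k ∨ (k' = k ∧ j' < j) →
        D k' j' (c.run 2 (Function.update (Function.update ρ 2 k) 3 j) B)) :
    I ((loop (loop c)).run 0 ρ A) ∧
      ∀ k < ρ 0, ∀ j < ρ 0, D k j ((loop (loop c)).run 0 ρ A) := by
  have := run_loop (c := loop c) (l := 0) (ρ := ρ) (A := A)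
    (fun k B => (∀ a, a ∉ c.writes → B a = A a) ∧ I B ∧ ∀ k' j', j' < ρ 0 → k' < k → D k' j' B)
    ⟨fun _ _ => rfl, h0, fun _ _ _ h => by omega⟩ ?_
  · exact ⟨this.2.1, fun k hk j hj => this.2.2 k j hj hk⟩
  · rintro k B hk - ⟨hB, hI, hD⟩
    have := run_loop (c := c) (l := 1) (ρ := Function.update ρ 2 k) (A := B)
      (fun j B => (∀ a, a ∉ c.writes → B a = A a) ∧ I B ∧
        ∀ k' j', j' < ρ 0 → k' < k ∨ (k' = k ∧ j' < j) → D k' j' B)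
      ⟨hB, hI, fun k' j' h1 h2 => hD k' j' h1 (by omega)⟩ ?_
    · rw [Function.update_of_ne (by norm_num)] at this
      exact ⟨this.1, this.2.1, fun k' j' h1 h2 => this.2.2 k' j' h1 (by omega)⟩
    · rintro j B hj - ⟨hB, hI, hD⟩
      rw [Function.update_of_ne (by norm_num)] at hj
      obtain ⟨h0, h1, h2⟩ := hstep k j B hk hj hB hI hD
      refine ⟨fun a ha => ?_, h0, fun k' j' h3 h4 => ?_⟩
      · rw [run_of_notMem_writes _ _ _ _ _ ha, hB a ha]
      · by_cases h5 : k' = k ∧ j' = j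
        · rw [h5.1, h5.2]
          exact h1
        · exact h2 k' j' h3 (by omega)

/-- Uniqueness of division with remainder: different cells of a matrix stored row by row do not
collide. -/
theorem mul_add_inj {N u v u' v' : ℕ} (hv : v < N) (hv' : v' < N) :
    u * N + v = u' * N + v' ↔ u = u' ∧ v = v' := by
  constructor
  · intro h
    have h1 : u = u' := by
      have h2 : (v + N * u) / N = (v' + N * u') / N := by
        congr 1
        linarith [mul_comm N u, mul_comm N u']
      have h0 : 0 < N := by omega
      rwa [Nat.add_mul_div_left _ _ h0, Nat.add_mul_div_left _ _ h0, Nat.div_eq_of_lt hv,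
        Nat.div_eq_of_lt hv', zero_add, zero_add] at h2
    subst h1
    exact ⟨rfl, by omega⟩
  · rintro ⟨rfl, rfl⟩
    rfl

/-! ### Recovering the geometry of the grid from distances -/

/-- Finds a neighbour of the root. -/
def neighbour : Cmd :=
  .seq (.write 12 (.const 0) (.reg 1))
    (.loop (ifLess (.const 0) (.entry 0 (.reg 1) (.reg 2)) (.write 12 (.const 0) (.reg 2))))

/-- Finds the farthest vertex that is closer to the root than to its neighbour. -/
def corner : Cmd :=
  .seq (.write 13 (.const 0) (.reg 1))
    (.loop (ifLess (.cell 3 (.reg 2)) (.cell 4 (.reg 2))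
      (ifLess (.cell 3 (.cell 13 (.const 0))) (.cell 3 (.reg 2))
        (.write 13 (.const 0) (.reg 2)))))

/-- Numbers the vertices of each layer. -/
def positions : Cmd :=
  .loop (.seq (.write 6 (.reg 2) (.const 0))
    (.loop (ifEq (.cell 3 (.reg 3)) (.cell 3 (.reg 2))
      (ifLess (.cell 5 (.reg 3)) (.cell 5 (.reg 2))
        (.write 6 (.reg 2) (.add (.cell 6 (.reg 2)) (.const 1)))))))

/-- Computes the largest distance from the root. -/
def depth : Cmd :=
  .loop (ifLess (.cell 14 (.const 0)) (.cell 3 (.reg 2))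
    (.write 14 (.const 0) (.cell 3 (.reg 2))))

/-- The number of vertices on the side of the grid that ends at the vertex found by `corner`. -/
def sideA : Expr := .add (.cell 3 (.cell 13 (.const 0))) (.const 1)

/-- The number of vertices on the other side. -/
def sideB : Expr := .sub (.add (.cell 14 (.const 0)) (.const 1)) (.cell 3 (.cell 13 (.const 0)))

/-- Computes the lengths of the sides. -/
def sides : Cmd :=
  .seq (.write 15 (.const 0) (.sub sideA (.sub sideA sideB)))
    (.write 16 (.const 0) (.add sideA (.sub sideB sideA)))

section Graph

variable {N : ℕ} {G : SimpleGraph (Fin N)} {r : Fin N} {ρ : ℕ → ℕ} {A : ℕ → ℕ → ℕ}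

theorem run_neighbour (hρ : ρ 0 = N) (hr : ρ 1 = r) (hA : HoldsGraph G A) :
    ∃ w : Fin N, neighbour.run 0 ρ A 12 0 = w ∧
      (G.Adj r w ∨ (w = r ∧ ∀ v, ¬ G.Adj r v)) := by
  have := run_loop
    (c := ifLess (.const 0) (.entry 0 (.reg 1) (.reg 2)) (.write 12 (.const 0) (.reg 2)))
    (l := 0) (ρ := ρ) (A := (Cmd.write 12 (.const 0) (.reg 1)).run 0 ρ A)
    (fun k B => HoldsGraph G B ∧ ∃ w : Fin N, B 12 0 = w ∧
      (G.Adj r w ∨ (w = r ∧ ∀ v : Fin N, (v : ℕ) < k → ¬ G.Adj r v)))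
    ⟨hA.congr rfl rfl, r, by simp [run, Expr.eval, hr], Or.inr ⟨rfl, fun v hv => by omega⟩⟩ ?_
  · obtain ⟨-, w, h1, h2⟩ := this
    refine ⟨w, h1, h2.imp_right fun h => ⟨h.1, fun v => h.2 v (by rw [hρ]; exact v.2)⟩⟩
  · rintro k B hk - ⟨hB, w, h1, h2⟩
    rw [hρ] at hk
    have hadj := hB.adj r ⟨k, hk⟩
    generalize hC : Cmd.run _ _ _ _ = C
    simp only [run_ifLess, Expr.eval, Expr.entry, run] at hC
    norm_num [hr, hB.mul r r.2.le] at hC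
    split_ifs at hC with h <;> subst hC
    · exact ⟨hB.congr rfl rfl, ⟨k, hk⟩, by simp, Or.inl (hadj.1 h)⟩
    · refine ⟨hB, w, h1, h2.imp_right fun h' => ⟨h'.1, fun v hv => ?_⟩⟩
      rcases Nat.lt_succ_iff_lt_or_eq.1 hv with hv | hv
      · exact h'.2 v hv
      · obtain rfl : v = ⟨k, hk⟩ := Fin.ext hv
        exact fun hh => h (hadj.2 hh)

theorem run_corner (hρ : ρ 0 = N) (hr : ρ 1 = r) :
    ∃ c : Fin N, corner.run 0 ρ A 13 0 = c ∧ (c = r ∨ A 3 c < A 4 c) ∧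
      ∀ v : Fin N, A 3 v < A 4 v → A 3 v ≤ A 3 c := by
  have := run_loop
    (c := ifLess (.cell 3 (.reg 2)) (.cell 4 (.reg 2))
      (ifLess (.cell 3 (.cell 13 (.const 0))) (.cell 3 (.reg 2))
        (.write 13 (.const 0) (.reg 2))))
    (l := 0) (ρ := ρ) (A := (Cmd.write 13 (.const 0) (.reg 1)).run 0 ρ A)
    (fun k B => B 3 = A 3 ∧ B 4 = A 4 ∧ ∃ c : Fin N, B 13 0 = c ∧ (c = r ∨ A 3 c < A 4 c) ∧
      ∀ v : Fin N, (v : ℕ) < k → A 3 v < A 4 v → A 3 v ≤ A 3 c)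
    ⟨rfl, rfl, r, by simp [run, Expr.eval, hr], Or.inl rfl, fun v hv => by omega⟩ ?_
  · obtain ⟨-, -, c, h1, h2, h3⟩ := this
    exact ⟨c, h1, h2, fun v => h3 v (by rw [hρ]; exact v.2)⟩
  · rintro k B hk - ⟨hB3, hB4, c, h1, h2, h3⟩
    rw [hρ] at hk
    generalize hC : Cmd.run _ _ _ _ = C
    simp only [run_ifLess, Expr.eval, run, h1, hB3, hB4] at hC
    norm_num [hB3, hB4] at hC
    split_ifs at hC with h h' <;> subst hC
    · refine ⟨hB3, hB4, ⟨k, hk⟩, by simp, Or.inr h, fun v hv hv' => ?_⟩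
      rcases Nat.lt_succ_iff_lt_or_eq.1 hv with hv | hv
      · exact (h3 v hv hv').trans h'.le
      · rw [hv]
    · refine ⟨hB3, hB4, c, h1, h2, fun v hv hv' => ?_⟩
      rcases Nat.lt_succ_iff_lt_or_eq.1 hv with hv | hv
      · exact h3 v hv hv'
      · rw [hv]
        omega
    · refine ⟨hB3, hB4, c, h1, h2, fun v hv hv' => ?_⟩
      rcases Nat.lt_succ_iff_lt_or_eq.1 hv with hv | hv
      · exact h3 v hv hv'
      · rw [hv] at hv'
        omega

theorem run_positions (v : ℕ) (hv : v < ρ 0) :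
    positions.run 0 ρ A 6 v = Nat.count (fun u => A 3 u = A 3 v ∧ A 5 u < A 5 v) (ρ 0) := by
  have := run_loop
    (c := .seq (.write 6 (.reg 2) (.const 0))
      (.loop (ifEq (.cell 3 (.reg 3)) (.cell 3 (.reg 2))
        (ifLess (.cell 5 (.reg 3)) (.cell 5 (.reg 2))
          (.write 6 (.reg 2) (.add (.cell 6 (.reg 2)) (.const 1)))))))
    (l := 0) (ρ := ρ) (A := A)
    (fun k B => B 3 = A 3 ∧ B 5 = A 5 ∧ ∀ v < k, B 6 v =
      Nat.count (fun u => A 3 u = A 3 v ∧ A 5 u < A 5 v) (ρ 0))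
    ⟨rfl, rfl, fun v hv => by omega⟩ ?_
  · exact this.2.2 v hv
  · rintro k B hk - ⟨hB3, hB5, hB⟩
    have key := run_loop
      (c := ifEq (.cell 3 (.reg 3)) (.cell 3 (.reg 2))
        (ifLess (.cell 5 (.reg 3)) (.cell 5 (.reg 2))
          (.write 6 (.reg 2) (.add (.cell 6 (.reg 2)) (.const 1)))))
      (l := 1) (ρ := Function.update ρ 2 k)
      (A := (Cmd.write 6 (.reg 2) (.const 0)).run 1 (Function.update ρ 2 k) B)
      (fun j C => C 3 = A 3 ∧ C 5 = A 5 ∧ (∀ v < k, C 6 v = B 6 v) ∧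
        C 6 k = Nat.count (fun u => A 3 u = A 3 k ∧ A 5 u < A 5 k) j) ?_ ?_
    · rw [Function.update_of_ne (by norm_num)] at key
      obtain ⟨k1, k2, k3, k4⟩ := key
      refine ⟨k1, k2, fun v hv => ?_⟩
      rcases Nat.lt_succ_iff_lt_or_eq.1 hv with hv | rfl
      · exact (k3 v hv).trans (hB v hv)
      · exact k4
    · simp only [run, Expr.eval]
      refine ⟨by simpa using hB3, by simpa using hB5, fun v hv => ?_, by simp⟩
      simp [hv.ne]
    · rintro j C - - ⟨h1, h2, h3, h4⟩
      rw [Nat.count_succ]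
      generalize hE : Cmd.run _ _ _ _ = E
      simp only [run_ifEq, run_ifLess, Expr.eval, run, h1, h2] at hE
      norm_num [h1, h2] at hE
      split_ifs at hE ⊢ with h5 h6 h7 <;> first | omega | subst hE
      · refine ⟨h1, h2, fun v hv => ?_, by simp [h4]⟩
        simp [hv.ne, h3 v hv]
      · exact ⟨h1, h2, h3, h4⟩
      · exact ⟨h1, h2, h3, h4⟩

theorem run_depth (hρ : ρ 0 = N) (h0 : A 14 0 = 0) :
    (∀ v : Fin N, A 3 v ≤ depth.run 0 ρ A 14 0) ∧
      (depth.run 0 ρ A 14 0 = 0 ∨ ∃ v : Fin N, depth.run 0 ρ A 14 0 = A 3 v) := by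
  have := run_loop
    (c := ifLess (.cell 14 (.const 0)) (.cell 3 (.reg 2))
      (.write 14 (.const 0) (.cell 3 (.reg 2))))
    (l := 0) (ρ := ρ) (A := A)
    (fun k B => B 3 = A 3 ∧ (∀ v : Fin N, (v : ℕ) < k → A 3 v ≤ B 14 0) ∧
      (B 14 0 = 0 ∨ ∃ v : Fin N, B 14 0 = A 3 v))
    ⟨rfl, fun v hv => by omega, Or.inl h0⟩ ?_
  · exact ⟨fun v => this.2.1 v (by rw [hρ]; exact v.2), this.2.2⟩
  · rintro k B hk - ⟨h1, h2, h3⟩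
    rw [hρ] at hk
    generalize hC : Cmd.run _ _ _ _ = C
    simp only [run_ifLess, Expr.eval, run, h1] at hC
    norm_num [h1] at hC
    split_ifs at hC with h <;> subst hC
    · refine ⟨h1, fun v hv => ?_, Or.inr ⟨⟨k, hk⟩, by simp⟩⟩
      simp only [Function.update_self]
      rcases Nat.lt_succ_iff_lt_or_eq.1 hv with hv | hv
      · exact (h2 v hv).trans h.le
      · rw [hv]
    · refine ⟨h1, fun v hv => ?_, h3⟩
      rcases Nat.lt_succ_iff_lt_or_eq.1 hv with hv | hv
      · exact h2 v hv
      · rw [hv]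
        omega

theorem run_sides {n m : ℕ} (hn : A 3 (A 13 0) + 1 = n) (hm : A 14 0 + 1 - A 3 (A 13 0) = m) :
    sides.run 0 ρ A 15 0 = min n m ∧ sides.run 0 ρ A 16 0 = max n m := by
  simp only [sides, sideA, sideB, run, Expr.eval]
  norm_num
  omega

end Graph

/-! ### Tables of merges, parents, positions and ranks -/

/-- The length of the shorter side. -/
def short : Expr := .cell 15 (.const 0)

/-- The length of the longer side. -/
def long : Expr := .cell 16 (.const 0)

/-- Finds the place of the merged subtree. -/
def findIndex : Cmd :=
  .loop (ifLess (.const 1) (.reg 3) (ifLess (.add (.reg 3) (.reg 2)) short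
    (ifLess (.entry 7 (.reg 2) (.reg 3))
      (.add (.entry 7 (.reg 2) (.const 0)) (.entry 7 (.reg 2) (.const 1)))
      (.write 8 (.reg 2) (.sub (.reg 3) (.const 1))))))

/-- Writes `1 + x` as the entry of array `7` that belongs to the next row and register `3`. -/
def writeSize (x : Expr) : Cmd :=
  .write 7 (.add (.add (.cell 2 (.reg 2)) (.reg 0)) (.reg 3)) (.add (.const 1) x)

/-- Merges the two smallest subtrees again and again. -/
def merging : Cmd :=
  .seq (.loop (.write 7 (.reg 2) (.add (.add (.sub long short) (.const 1)) (.reg 2))))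
    (.loop (.seq findIndex (.loop
      (.ifLt (.reg 3) (.cell 8 (.reg 2))
        (writeSize (.entry 7 (.reg 2) (.add (.reg 3) (.const 2))))
        (.ifLt (.cell 8 (.reg 2)) (.reg 3)
          (writeSize (.entry 7 (.reg 2) (.add (.reg 3) (.const 1))))
          (writeSize (.add (.entry 7 (.reg 2) (.const 0)) (.entry 7 (.reg 2) (.const 1)))))))))

/-- The merge index of the layer in register `2`. -/
def layerIndex : Expr := .cell 8 (.sub (.sub short (.const 2)) (.reg 2))

/-- Writes `x` as the entry of array `9` that belongs to the registers `2` and `3`. -/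
def writeParent (x : Expr) : Cmd := .write 9 (.add (.cell 2 (.reg 2)) (.reg 3)) x

/-- Computes the ranks of the parents. -/
def parents : Cmd :=
  .loop (.loop (.ifLt (.add (.reg 2) (.const 1)) short
    (.ifLt (.reg 3) (.const 2) (writeParent layerIndex)
      (.ifLt (.sub (.reg 3) (.const 2)) layerIndex (writeParent (.sub (.reg 3) (.const 2)))
        (writeParent (.sub (.reg 3) (.const 1)))))
    (writeParent (.reg 3))))

/-- Writes `x` as the entry of array `10` that belongs to the next layer and register `3`. -/
def writePos (x : Expr) : Cmd :=
  .write 10 (.add (.add (.cell 2 (.reg 2)) (.reg 0)) (.reg 3)) x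

/-- The position of the parent. -/
def parentPos : Expr := .entry 10 (.reg 2) (.entry 9 (.reg 2) (.reg 3))

/-- Computes the positions of the ranks. -/
def rankPositions : Cmd :=
  .loop (.loop (.ifLt (.add (.reg 2) (.const 1)) short
    (.ifLt (.reg 3) (.const 2) (writePos (.add (.entry 10 (.reg 2) layerIndex) (.reg 3)))
      (.ifLt (.entry 10 (.reg 2) layerIndex) parentPos (writePos (.add parentPos (.const 1)))
        (writePos parentPos)))
    (.ifLt (.add (.reg 2) (.const 1)) long (writePos parentPos)
      (.ifLt (.entry 10 (.reg 2) (.sub (.add (.reg 2) (.const 1)) long)) parentPos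
        (writePos (.sub parentPos (.const 1))) (writePos parentPos)))))

/-- Computes the ranks of the vertices. -/
def vertexRanks : Cmd :=
  .loop (.loop (ifEq (.entry 10 (.cell 3 (.reg 2)) (.reg 3)) (.cell 6 (.reg 2))
    (ifLess (.cell 3 (.reg 2)) (.add (.reg 3) long)
      (ifLess (.reg 3) (.add (.cell 3 (.reg 2)) (.const 1))
        (ifLess (.reg 3) short (.write 11 (.reg 2) (.reg 3)))))))

/-- Writes the edges of the tree. -/
def edges : Cmd :=
  .loop (.loop (.seq (.write 1 (.add (.cell 2 (.reg 2)) (.reg 3)) (.const 0))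
    (ifEq (.cell 3 (.reg 3)) (.add (.cell 3 (.reg 2)) (.const 1))
      (ifEq (.cell 11 (.reg 2)) (.entry 9 (.cell 3 (.reg 2)) (.cell 11 (.reg 3)))
        (.write 1 (.add (.cell 2 (.reg 2)) (.reg 3)) (.const 1))))))

variable {N a b : ℕ} {ρ : ℕ → ℕ} {A : ℕ → ℕ → ℕ}

/-- The arrays `2`, `15` and `16` hold the multiples of `N` and the lengths of the sides. -/
structure HoldsSides (N a b : ℕ) (A : ℕ → ℕ → ℕ) : Prop where
  mul : ∀ u ≤ N, A 2 u = u * N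
  short : A 15 0 = a
  long : A 16 0 = b

theorem HoldsSides.congr (h : HoldsSides N a b A) {B : ℕ → ℕ → ℕ} (h2 : B 2 = A 2)
    (h15 : B 15 = A 15) (h16 : B 16 = A 16) : HoldsSides N a b B :=
  ⟨by rw [h2]; exact h.mul, by rw [h15]; exact h.short, by rw [h16]; exact h.long⟩

/-- The loop performs the recursion of `insertionIndex`: each smaller entry overwrites the result,
so the last one counts. The initial 0 covers the case without such an entry. -/
theorem run_findIndex {t : ℕ} (hρ : ρ 0 = N) (ht : ρ 2 = t) (htN : t ≤ N)
    (hA : HoldsSides N a b A) (h8 : A 8 t = 0) (haN : a ≤ N) :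
    findIndex.run 1 ρ A 8 t = insertionIndex (fun p => A 7 (t * N + p)) (a - t) ∧
      ∀ i, i ≠ t → findIndex.run 1 ρ A 8 i = A 8 i := by
  have := run_loop
    (c := ifLess (.const 1) (.reg 3) (ifLess (.add (.reg 3) (.reg 2)) short
      (ifLess (.entry 7 (.reg 2) (.reg 3))
        (.add (.entry 7 (.reg 2) (.const 0)) (.entry 7 (.reg 2) (.const 1)))
        (.write 8 (.reg 2) (.sub (.reg 3) (.const 1))))))
    (l := 1) (ρ := ρ) (A := A)
    (fun k B => HoldsSides N a b B ∧ B 7 = A 7 ∧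
      B 8 t = insertionIndex (fun p => A 7 (t * N + p)) (min k (a - t)) ∧
      ∀ i, i ≠ t → B 8 i = A 8 i)
    ⟨hA, rfl, by simp [h8, insertionIndex], fun _ _ => rfl⟩ ?_
  · obtain ⟨-, -, h1, h2⟩ := this
    rw [hρ, min_eq_right (by omega)] at h1
    exact ⟨h1, h2⟩
  · rintro k B hk - ⟨hB, h7, h8, hi⟩
    generalize hC : Cmd.run _ _ _ _ = C
    simp only [run_ifLess, Expr.eval, Expr.entry, run, short] at hC
    norm_num [ht, hB.mul t htN, hB.short, h7] at hC
    by_cases hkt : k < a - t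
    · rw [min_eq_left (by omega)] at h8
      rw [min_eq_left (by omega), insertionIndex]
      by_cases hcond : 1 < k ∧ A 7 (t * N + k) < A 7 (t * N + 0) + A 7 (t * N + 1)
      · rw [add_zero] at hcond
        rw [if_pos hcond.1, if_pos (by omega), if_pos hcond.2] at hC
        subst hC
        refine ⟨hB.congr rfl rfl rfl, h7, ?_, fun i hi' => ?_⟩
        · rw [if_pos (by rw [add_zero]; exact hcond)]
          simp
        · simp [hi', hi i hi']
      · have hC' : C = B := by
          rw [add_zero] at hcond
          split_ifs at hC <;> first | exact hC.symm | omega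
        rw [hC', if_neg hcond]
        exact ⟨hB, h7, h8, hi⟩
    · have hC' : C = B := by
        split_ifs at hC <;> first | exact hC.symm | omega
      rw [min_eq_right (by omega)] at h8 ⊢
      rw [hC']
      exact ⟨hB, h7, h8, hi⟩

theorem insertionIndex_congr {x y : ℕ → ℕ} {l : ℕ} (h : ∀ p < l, x p = y p) :
    insertionIndex x l = insertionIndex y l := by
  have : ∀ k ≤ l, insertionIndex x k = insertionIndex y k := by
    intro k
    induction k with
    | zero => exact fun _ => rfl
    | succ k ih =>
      intro hk
      rw [insertionIndex, insertionIndex, ih (by omega)]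
      by_cases hk1 : 1 < k
      · rw [h k (by omega), h 0 (by omega), h 1 (by omega)]
      · rw [if_neg (by tauto), if_neg (by tauto)]
  exact this l le_rfl

theorem lt_row {N t k p : ℕ} (ht : t < k) (hp : p < N) (q : ℕ) : t * N + p < k * N + q := by
  have := Nat.mul_le_mul_right N (show t + 1 ≤ k from ht)
  rw [add_mul] at this
  omega

/-- Row `t` of array `7` holds the sizes at time `t`. Only its first `a - t` entries have a meaning;
the loops run to `N` and also fill irrelevant cells, hence the conditions in the invariants. -/
theorem run_merging (hρ : ρ 0 = N) (hA : HoldsSides N a b A) (h8 : ∀ i, A 8 i = 0) (haN : a ≤ N)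
    {t : ℕ} (ht : t < a) : merging.run 0 ρ A 8 t = mergeIndex a (b - a) t := by
  have hinit : HoldsSides N a b
      ((loop (.write 7 (.reg 2) (.add (.add (.sub long short) (.const 1)) (.reg 2)))).run 0 ρ A) ∧
      (∀ i, (loop (.write 7 (.reg 2) (.add (.add (.sub long short) (.const 1)) (.reg 2)))).run
        0 ρ A 8 i = 0) ∧ ∀ p < ρ 0,
      (loop (.write 7 (.reg 2) (.add (.add (.sub long short) (.const 1)) (.reg 2)))).run 0 ρ A 7 p =
        mergeSizes a (b - a) 0 p := by
    refine run_loop (fun k B => HoldsSides N a b B ∧ (∀ i, B 8 i = 0) ∧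
      ∀ p < k, B 7 p = mergeSizes a (b - a) 0 p) ⟨hA, h8, fun p hp => by omega⟩ ?_
    rintro k B hk - ⟨h1, h2, h3⟩
    simp only [run, Expr.eval, short, long, h1.short, h1.long]
    norm_num
    refine ⟨h1.congr rfl rfl rfl, h2, fun p hp => ?_⟩
    rw [Function.update_apply]
    split_ifs with h
    · rw [h]
      rfl
    · exact h3 p (by omega)
  set A₁ := (loop (.write 7 (.reg 2) (.add (.add (.sub long short) (.const 1)) (.reg 2)))).run 0 ρ A
  have main := run_loop (c := .seq findIndex (.loop
      (.ifLt (.reg 3) (.cell 8 (.reg 2))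
        (writeSize (.entry 7 (.reg 2) (.add (.reg 3) (.const 2))))
        (.ifLt (.cell 8 (.reg 2)) (.reg 3)
          (writeSize (.entry 7 (.reg 2) (.add (.reg 3) (.const 1))))
          (writeSize (.add (.entry 7 (.reg 2) (.const 0)) (.entry 7 (.reg 2) (.const 1))))))))
    (l := 0) (ρ := ρ) (A := A₁)
    (fun k B => HoldsSides N a b B ∧ (∀ i, k ≤ i → B 8 i = 0) ∧
      (∀ t < k, t < a → B 8 t = mergeIndex a (b - a) t) ∧
      ∀ t ≤ k, t < a → ∀ p < a - t, B 7 (t * N + p) = mergeSizes a (b - a) t p)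
    ⟨hinit.1, fun i _ => hinit.2.1 i, fun t ht => by omega, fun t ht hta p hp => ?_⟩ ?_
  · rw [hρ] at main
    exact main.2.2.1 t (by omega) ht
  · obtain rfl : t = 0 := by omega
    rw [zero_mul, zero_add]
    exact hinit.2.2 p (by omega)
  · rintro k B hk - ⟨h1, h2, h3, h4⟩
    rw [hρ] at hk
    obtain ⟨f1, f2⟩ := run_findIndex (ρ := Function.update ρ 2 k) (t := k)
      (by rw [Function.update_of_ne (by norm_num), hρ]) (by simp) hk.le h1 (h2 k le_rfl) haN
    have f3 := fun i (hi : i ≠ 8) => run_of_notMem_writes findIndex 1 (Function.update ρ 2 k) B i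
      (by simpa [findIndex, writes] using hi)
    rw [run, zero_add, zero_add]
    set C := findIndex.run 1 (Function.update ρ 2 k) B
    have hC : HoldsSides N a b C := h1.congr (f3 _ (by norm_num)) (f3 _ (by norm_num))
      (f3 _ (by norm_num))
    have hC7 : C 7 = B 7 := f3 7 (by norm_num)
    have main := run_loop (c := .ifLt (.reg 3) (.cell 8 (.reg 2))
        (writeSize (.entry 7 (.reg 2) (.add (.reg 3) (.const 2))))
        (.ifLt (.cell 8 (.reg 2)) (.reg 3)
          (writeSize (.entry 7 (.reg 2) (.add (.reg 3) (.const 1))))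
          (writeSize (.add (.entry 7 (.reg 2) (.const 0)) (.entry 7 (.reg 2) (.const 1))))))
      (l := 1) (ρ := Function.update ρ 2 k) (A := C)
      (fun j E => HoldsSides N a b E ∧ E 8 = C 8 ∧
        (∀ i, i < (k + 1) * N → E 7 i = B 7 i) ∧
        ∀ p < j, p < a - (k + 1) → E 7 ((k + 1) * N + p) = mergeSizes a (b - a) (k + 1) p)
      ⟨hC, rfl, fun i _ => by rw [hC7], fun p hp => by omega⟩ ?_
    · rw [Function.update_of_ne (by norm_num), hρ] at main
      obtain ⟨m1, m2, m3, m4⟩ := main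
      refine ⟨m1, fun i hi => ?_, fun t ht hta => ?_, fun t ht hta p hp => ?_⟩
      · rw [m2, f2 i (by omega), h2 i (by omega)]
      · rw [m2]
        rcases Nat.lt_succ_iff_lt_or_eq.1 ht with ht | rfl
        · rw [f2 t (by omega), h3 t ht hta]
        · rw [f1]
          exact insertionIndex_congr fun p hp => h4 t le_rfl hta p hp
      · rcases Nat.lt_or_ge t (k + 1) with ht' | ht'
        · rw [m3 _ (lt_row ht' (by omega) 0), h4 t (by omega) hta p hp]
        · obtain rfl : t = k + 1 := by omega
          exact m4 p (by omega) hp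
    · rintro j E hj - ⟨e1, e2, e3, e4⟩
      rw [Function.update_of_ne (by norm_num), hρ] at hj
      have hrun : ∀ x : Expr, (writeSize x).run 2 (Function.update (Function.update ρ 2 k) 3 j) E =
          Function.update E 7 (Function.update (E 7) ((k + 1) * N + j)
            (1 + x.eval ⟨Function.update (Function.update ρ 2 k) 3 j, E⟩)) := by
        intro x
        simp only [writeSize, run, Expr.eval]
        norm_num [hρ, e1.mul k hk.le]
        rw [add_mul, one_mul]
      have hres : ∀ y : ℕ, (j < a - (k + 1) → 1 + y = mergeSizes a (b - a) (k + 1) j) →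
          let F := Function.update E 7 (Function.update (E 7) ((k + 1) * N + j) (1 + y))
          HoldsSides N a b F ∧ F 8 = C 8 ∧
            (∀ i, i < (k + 1) * N → F 7 i = B 7 i) ∧
            ∀ p < j + 1, p < a - (k + 1) →
              F 7 ((k + 1) * N + p) = mergeSizes a (b - a) (k + 1) p := by
        intro y hy F
        refine ⟨e1.congr rfl rfl rfl, e2, fun i hi => ?_, fun p hp hpa => ?_⟩
        · simp only [F, Function.update_self]
          rw [Function.update_of_ne (by omega), e3 i hi]
        · simp only [F, Function.update_self]
          by_cases hpj : p = j
          · subst hpj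
            rw [Function.update_self]
            exact hy hpa
          · rw [Function.update_of_ne (by omega)]
            exact e4 p (by omega) hpa
      have hq : k + 1 < a → C 8 k = insertionIndex (mergeSizes a (b - a) k) (a - k) := by
        intro hka
        rw [f1]
        exact insertionIndex_congr fun p hp => h4 k le_rfl (by omega) p hp
      have h7 : ∀ p, k + 1 < a → p < a - k → E 7 (k * N + p) = mergeSizes a (b - a) k p := by
        intro p hka hp
        rw [e3 _ (lt_row (Nat.lt_succ_self k) (by omega) 0), h4 k le_rfl (by omega) p hp]
      have hle : k + 1 < a → insertionIndex (mergeSizes a (b - a) k) (a - k) + 2 ≤ a - k :=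
        fun hka => insertionIndex_add_two_le _ (by omega)
      generalize hF : Cmd.run _ _ _ _ = F
      rw [run, run] at hF
      norm_num only at hF
      rw [hrun, hrun, hrun] at hF
      simp only [Expr.eval, Expr.entry] at hF
      norm_num [e1.mul k hk.le, e2] at hF
      split_ifs at hF with c1 c2 <;> subst hF
      · refine hres _ fun hja => ?_
        have hq := hq (by omega)
        have hle := hle (by omega)
        rw [hq] at c1
        rw [h7 _ (by omega) (by omega)]
        simp only [mergeSizes, mergeStep, if_pos c1]
      · refine hres _ fun hja => ?_
        have hq := hq (by omega)
        rw [hq] at c1 c2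
        rw [h7 _ (by omega) (by omega)]
        simp only [mergeSizes, mergeStep, if_neg c1]
        rw [if_neg (by omega)]
      · refine hres _ fun hja => ?_
        have hq := hq (by omega)
        rw [hq] at c1 c2
        have h0 := h7 0 (by omega) (by omega)
        rw [add_zero] at h0
        rw [h0, h7 1 (by omega) (by omega)]
        simp only [mergeSizes, mergeStep, if_neg c1]
        rw [if_pos (by omega)]

variable {N a b : ℕ} {ρ : ℕ → ℕ} {A : ℕ → ℕ → ℕ}

theorem run_parents (hρ : ρ 0 = N) (hA : HoldsSides N a b A)
    (h8 : ∀ t < a, A 8 t = mergeIndex a (b - a) t) :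
    ∀ k < N, ∀ σ < N, parents.run 0 ρ A 9 (k * N + σ) = parentRank a b k σ := by
  subst hρ
  refine (run_loop_loop (fun _ => True)
    (fun k σ B => B 9 (k * ρ 0 + σ) = parentRank a b k σ) trivial ?_).2
  intro k j B hk hj hB _ ih
  have hwr : ∀ i, i ≠ 9 → B i = A i := fun i hi => hB i (by simpa [writes, writeParent] using hi)
  have h1 : HoldsSides (ρ 0) a b B := hA.congr (hwr _ (by norm_num)) (hwr _ (by norm_num))
    (hwr _ (by norm_num))
  have hrun : ∀ x : Expr, (writeParent x).run 2 (Function.update (Function.update ρ 2 k) 3 j) B =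
      Function.update B 9 (Function.update (B 9) (k * ρ 0 + j)
        (x.eval ⟨Function.update (Function.update ρ 2 k) 3 j, B⟩)) := by
    intro x
    simp only [writeParent, run, Expr.eval]
    norm_num [h1.mul k hk.le]
  have hidx : layerIndex.eval ⟨Function.update (Function.update ρ 2 k) 3 j, B⟩ = A 8 (a - 2 - k) := by
    simp only [layerIndex, short, Expr.eval]
    norm_num [h1.short, hwr]
  suffices hF : Cmd.run _ 2 (Function.update (Function.update ρ 2 k) 3 j) B =
      Function.update B 9 (Function.update (B 9) (k * ρ 0 + j) (parentRank a b k j)) by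
    rw [hF]
    refine ⟨trivial, by simp, fun k' j' hj' hlt => ?_⟩
    rw [Function.update_self, Function.update_of_ne, ih k' j' hj' hlt]
    rw [ne_eq, mul_add_inj hj' hj]
    omega
  simp only [run, hrun, hidx, short]
  simp only [Expr.eval]
  norm_num [h1.short]
  rw [parentRank]
  by_cases hka : k + 1 < a
  · rw [if_pos hka, if_pos hka, h8 _ (by omega)]
    split_ifs <;> first | rfl | omega
  · rw [if_neg hka, if_neg hka]

theorem parentRank_lt {k σ : ℕ} (hk : k < N) (hσ : σ < N) : parentRank a b k σ < N := by
  unfold parentRank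
  split_ifs with h
  · have := mergeIndex_le (b := b) h
    omega
  · omega
  · omega
  · omega

/-- Row `k + 1` is computed from row `k`. Row 0 is never written, and its initial zeros are the
values of `layerPos a b 0`. -/
theorem run_rankPositions (hρ : ρ 0 = N) (hA : HoldsSides N a b A) (hb : 1 ≤ b)
    (h8 : ∀ t < a, A 8 t = mergeIndex a (b - a) t)
    (h9 : ∀ k < N, ∀ σ < N, A 9 (k * N + σ) = parentRank a b k σ)
    (h10 : ∀ σ, A 10 σ = 0) :
    ∀ k < N, ∀ σ < N, rankPositions.run 0 ρ A 10 (k * N + σ) = layerPos a b k σ := by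
  subst hρ
  have main := run_loop_loop (ρ := ρ) (A := A)
    (c := .ifLt (.add (.reg 2) (.const 1)) short
    (.ifLt (.reg 3) (.const 2) (writePos (.add (.entry 10 (.reg 2) layerIndex) (.reg 3)))
      (.ifLt (.entry 10 (.reg 2) layerIndex) parentPos (writePos (.add parentPos (.const 1)))
        (writePos parentPos)))
    (.ifLt (.add (.reg 2) (.const 1)) long (writePos parentPos)
      (.ifLt (.entry 10 (.reg 2) (.sub (.add (.reg 2) (.const 1)) long)) parentPos
        (writePos (.sub parentPos (.const 1))) (writePos parentPos))))
    (fun B => ∀ i < ρ 0, B 10 i = 0)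
    (fun k σ B => B 10 ((k + 1) * ρ 0 + σ) = layerPos a b (k + 1) σ) (fun i _ => h10 i) ?_
  · intro k hk σ hσ
    cases k with
    | zero =>
      rw [zero_mul, zero_add]
      exact main.1 σ hσ
    | succ k => exact main.2 k (by omega) σ hσ
  intro k j B hk hj hB hI ih
  have hwr : ∀ i, i ≠ 10 → B i = A i := fun i hi => hB i (by simpa [writes, writePos] using hi)
  have h1 : HoldsSides (ρ 0) a b B := hA.congr (hwr _ (by norm_num)) (hwr _ (by norm_num))
    (hwr _ (by norm_num))
  have hpos : ∀ σ < ρ 0, B 10 (k * ρ 0 + σ) = layerPos a b k σ := by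
    intro σ hσ
    cases k with
    | zero =>
      rw [zero_mul, zero_add]
      exact hI σ hσ
    | succ k => exact ih k σ hσ (by omega)
  have hrun : ∀ x : Expr, (writePos x).run 2 (Function.update (Function.update ρ 2 k) 3 j) B =
      Function.update B 10 (Function.update (B 10) ((k + 1) * ρ 0 + j)
        (x.eval ⟨Function.update (Function.update ρ 2 k) 3 j, B⟩)) := by
    intro x
    simp only [writePos, run, Expr.eval]
    norm_num [h1.mul k hk.le]
    rw [add_mul, one_mul]
  have hidx : layerIndex.eval ⟨Function.update (Function.update ρ 2 k) 3 j, B⟩ =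
      A 8 (a - 2 - k) := by
    simp only [layerIndex, short, Expr.eval]
    norm_num [h1.short, hwr]
  have hpar : parentPos.eval ⟨Function.update (Function.update ρ 2 k) 3 j, B⟩ =
      layerPos a b k (parentRank a b k j) := by
    simp only [parentPos, Expr.entry, Expr.eval]
    norm_num [h1.mul k hk.le, hwr 9]
    rw [h9 k hk j hj, hpos _ (parentRank_lt hk hj)]
  suffices hF : Cmd.run _ 2 (Function.update (Function.update ρ 2 k) 3 j) B =
      Function.update B 10 (Function.update (B 10) ((k + 1) * ρ 0 + j)
        (layerPos a b (k + 1) j)) by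
    rw [hF]
    refine ⟨fun i hi => ?_, by simp, fun k' j' hj' hlt => ?_⟩
    · rw [Function.update_self, Function.update_of_ne, hI i hi]
      have := lt_row (show 0 < k + 1 by omega) hi j
      rw [zero_mul] at this
      omega
    · rw [Function.update_self, Function.update_of_ne, ih k' j' hj' hlt]
      rw [ne_eq, mul_add_inj hj' hj]
      omega
  simp only [run, hrun]
  simp only [Expr.eval, Expr.entry, hidx, hpar, short, long]
  norm_num [h1.mul k hk.le, h1.short, h1.long]
  rw [layerPos]
  beta_reduce
  by_cases hka : k + 1 < a
  · have hq := mergeIndex_le (b := b) hka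
    rw [h8 _ (by omega), hpos _ (by omega), if_pos hka, if_pos hka]
    split_ifs <;> first | rfl | omega
  · rw [if_neg hka, if_neg hka, hpos _ (by omega)]
    split_ifs <;> rfl

/-- Layer position is inverted by exhaustive search. Uniqueness of the rank is not needed: a hit can
only be overwritten by another valid rank. -/
theorem run_vertexRanks (hρ : ρ 0 = N) (hA : HoldsSides N a b A) (haN : a ≤ N)
    (h3 : ∀ v < N, A 3 v < N)
    (h10 : ∀ k < N, ∀ σ < N, A 10 (k * N + σ) = layerPos a b k σ)
    {v : ℕ} (hv : v < N)
    (hex : ∃ σ ∈ ranks a b (A 3 v), layerPos a b (A 3 v) σ = A 6 v) :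
    vertexRanks.run 0 ρ A 11 v ∈ ranks a b (A 3 v) ∧
      layerPos a b (A 3 v) (vertexRanks.run 0 ρ A 11 v) = A 6 v := by
  subst hρ
  have := run_loop_loop (ρ := ρ) (A := A)
    (c := ifEq (.entry 10 (.cell 3 (.reg 2)) (.reg 3)) (.cell 6 (.reg 2))
      (ifLess (.cell 3 (.reg 2)) (.add (.reg 3) long)
        (ifLess (.reg 3) (.add (.cell 3 (.reg 2)) (.const 1))
          (ifLess (.reg 3) short (.write 11 (.reg 2) (.reg 3))))))
    (fun _ => True)
    (fun v σ B => σ ∈ ranks a b (A 3 v) → layerPos a b (A 3 v) σ = A 6 v →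
      B 11 v ∈ ranks a b (A 3 v) ∧ layerPos a b (A 3 v) (B 11 v) = A 6 v) trivial ?_
  · obtain ⟨σ, h1, h2⟩ := hex
    have h3 := (mem_ranks.1 h1).2.2
    exact this.2 v hv σ (by omega) h1 h2
  · intro k j B hk hj hB _ ih
    have hwr : ∀ i, i ≠ 11 → B i = A i := fun i hi => hB i (by simpa [writes] using hi)
    have h1 : HoldsSides (ρ 0) a b B := hA.congr (hwr _ (by norm_num)) (hwr _ (by norm_num))
      (hwr _ (by norm_num))
    have hrun : Cmd.run (ifEq (.entry 10 (.cell 3 (.reg 2)) (.reg 3)) (.cell 6 (.reg 2))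
      (ifLess (.cell 3 (.reg 2)) (.add (.reg 3) long)
        (ifLess (.reg 3) (.add (.cell 3 (.reg 2)) (.const 1))
          (ifLess (.reg 3) short (.write 11 (.reg 2) (.reg 3))))))
          2 (Function.update (Function.update ρ 2 k) 3 j) B =
        if layerPos a b (A 3 k) j = A 6 k ∧ j ∈ ranks a b (A 3 k) then
          Function.update B 11 (Function.update (B 11) k j) else B := by
      have e1 := h1.mul (A 3 k) (h3 k hk).le
      have e2 := h10 (A 3 k) (h3 k hk) j hj
      simp only [run_ifEq, run_ifLess, run, Expr.eval, Expr.entry, short, long, mem_ranks]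
      norm_num [hwr 3, hwr 6, hwr 10, h1.short, h1.long, e1, e2]
      split_ifs <;> first | rfl | omega
    rw [hrun]
    refine ⟨trivial, fun g1 g2 => ?_, fun k' j' hj' hlt g1 g2 => ?_⟩
    · rw [if_pos ⟨g2, g1⟩]
      simp [g1, g2]
    · have := ih k' j' hj' hlt g1 g2
      split_ifs with hc
      · rw [Function.update_self, Function.update_apply]
        split_ifs with hkk
        · rw [hkk]
          exact ⟨hc.2, hc.1⟩
        · exact this
      · exact this

theorem run_edges (hρ : ρ 0 = N) (h2 : ∀ u ≤ N, A 2 u = u * N) (h3 : ∀ v < N, A 3 v < N)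
    (h11 : ∀ v < N, A 11 v < N)
    (h9 : ∀ k < N, ∀ σ < N, A 9 (k * N + σ) = parentRank a b k σ) :
    ∀ u < N, ∀ v < N, (edges.run 0 ρ A 1 (u * N + v) ≠ 0 ↔
      A 3 v = A 3 u + 1 ∧ A 11 u = parentRank a b (A 3 u) (A 11 v)) := by
  subst hρ
  refine (run_loop_loop (fun _ => True)
    (fun u v B => B 1 (u * ρ 0 + v) ≠ 0 ↔
      A 3 v = A 3 u + 1 ∧ A 11 u = parentRank a b (A 3 u) (A 11 v)) trivial ?_).2
  intro k j B hk hj hB _ ih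
  have hwr : ∀ i, i ≠ 1 → B i = A i := fun i hi => hB i (by simpa [writes] using hi)
  suffices hF : Cmd.run _ 2 (Function.update (Function.update ρ 2 k) 3 j) B =
      Function.update B 1 (Function.update (B 1) (k * ρ 0 + j)
        (if A 3 j = A 3 k + 1 ∧ A 11 k = parentRank a b (A 3 k) (A 11 j) then 1 else 0)) by
    rw [hF]
    refine ⟨trivial, by simp, fun k' j' hj' hlt => ?_⟩
    rw [Function.update_self, Function.update_of_ne, ih k' j' hj' hlt]
    rw [ne_eq, mul_add_inj hj' hj]
    omega
  have e1 := h2 k hk.le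
  have e2 := h2 (A 3 k) (h3 k hk).le
  have e3 := h9 (A 3 k) (h3 k hk) (A 11 j) (h11 j hj)
  rw [run]
  generalize hC : (Cmd.write _ _ _).run _ _ _ = C
  simp only [run, Expr.eval] at hC
  norm_num [hwr 2, e1] at hC
  have hC' : ∀ i, i ≠ 1 → C i = A i := by
    intro i hi
    rw [← hC, Function.update_of_ne hi, hwr i hi]
  simp only [run_ifEq, run, Expr.eval, Expr.entry]
  norm_num [hC', e1, e2, e3]
  rw [← hC]
  split_ifs <;> first | omega | simp

/-! ### The whole algorithm and its correctness -/

/-- The Min-Min algorithm. -/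
def minMin : Cmd :=
  .seq multiples (.seq (distances 3 (.reg 1)) (.seq neighbour
    (.seq (distances 4 (.cell 12 (.const 0))) (.seq corner
      (.seq (distances 5 (.cell 13 (.const 0))) (.seq positions (.seq depth (.seq sides
        (.seq merging (.seq parents (.seq rankPositions (.seq vertexRanks edges))))))))))))

theorem count_eq_card_filter_univ (p : ℕ → Prop) [DecidablePred p] (N : ℕ) :
    Nat.count p N = (Finset.univ.filter fun u : Fin N => p u).card := by
  rw [Nat.count_eq_card_filter_range, Finset.card_filter, Finset.card_filter,
    Fin.sum_univ_eq_sum_range fun i => if p i then 1 else 0]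

variable {N : ℕ} {G : SimpleGraph (Fin N)} {r : Fin N}

theorem input_arr_pos_iff (u v : Fin N) : 0 < (input G r).arr 0 (u * N + v) ↔ G.Adj u v := by
  classical
  simp only [input, true_and]
  constructor
  · intro h
    split_ifs at h with h'
    · obtain ⟨u', v', e, hadj⟩ := h'
      rw [mul_add_inj v.2 v'.2] at e
      rwa [Fin.ext e.1, Fin.ext e.2]
    · omega
  · intro h
    rw [if_pos ⟨u, v, rfl, h⟩]
    exact one_pos

/-- The coordinates can be chosen such that a given neighbour of the root has the first
coordinate `0`. -/
theorem exists_gridCoord_of_adj {n m : ℕ} {I J : Fin N → ℕ} (h : GridCoord n m G r I J)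
    {w : Fin N} (hw : G.Adj r w ∨ (w = r ∧ ∀ v, ¬ G.Adj r v)) :
    ∃ n' m' I' J', GridCoord n' m' G r I' J' ∧ min n' m' = min n m ∧ max n' m' = max n m ∧
      I' w = 0 ∧ (J' w = 1 ∨ (w = r ∧ n' = 1)) := by
  have h1 := h.fst_root
  have h2 := h.snd_root
  rcases hw with hw | ⟨rfl, hno⟩
  · rw [h.adj] at hw
    by_cases hI : I w = 0
    · exact ⟨n, m, I, J, h, rfl, rfl, hI, Or.inl (by omega)⟩
    · exact ⟨m, n, J, I, h.swap, min_comm _ _, max_comm _ _, by omega, Or.inl (by omega)⟩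
  · refine ⟨n, m, I, J, h, rfl, rfl, h1, Or.inr ⟨rfl, ?_⟩⟩
    by_contra hn
    have := h.fst_lt w
    have := h.snd_lt w
    obtain ⟨v, e1, e2⟩ := h.surj 1 0 (by omega) (by omega)
    exact hno v ((h.adj _ _).2 (by omega))

theorem isRanking_output {n m : ℕ} {I J : Fin N → ℕ} (h : GridCoord n m G r I J) :
    ∃ rank, IsRanking (min n m) (max n m) G r rank
      (output N ⟨(input G r).reg, minMin.run 0 (input G r).reg (input G r).arr⟩) := by
  have hρ : (input G r).reg 0 = N := by simp [input]
  have hr : (input G r).reg 1 = r := by simp [input]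
  have hin : ∀ i, i ≠ 0 → ∀ x, (input G r).arr i x = 0 := by
    intro i hi x
    simp [input, hi]
  have hadj := input_arr_pos_iff (G := G) (r := r)
  simp only [minMin, run]
  generalize (input G r).reg = ρ at *
  generalize (input G r).arr = A0 at *
  have hG := h.connected
  -- At each stage `m` states what was computed and `f` that the other arrays are unchanged; the
  -- memory is then replaced by a variable, so only these facts remain.
  have m1 := run_multiples (ρ := ρ) (hin 2 (by norm_num) 0)
  have f1 := fun i (hi : i ≠ 2) => run_of_notMem_writes multiples 0 ρ A0 i
    (by simpa [multiples, writes] using hi)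
  generalize multiples.run 0 ρ A0 = A1 at *
  rw [hρ] at m1
  have g1 : HoldsGraph G A1 := ⟨by rw [f1 0 (by norm_num)]; exact hadj, m1⟩
  have m2 := run_distances hG hρ g1 (a := 3) (by norm_num) (by norm_num) (src := .reg 1) (s := r)
    (fun B _ => hr)
  have f2 := fun i (hi : i ≠ 3) => run_of_notMem_writes (distances 3 (.reg 1)) 0 ρ A1 i
    (by simpa [writes_distances] using hi)
  generalize (distances 3 (.reg 1)).run 0 ρ A1 = A2 at *
  have g2 : HoldsGraph G A2 := g1.congr (f2 0 (by norm_num)) (f2 2 (by norm_num))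
  obtain ⟨w, m3, hw⟩ := run_neighbour hρ hr g2
  have f3 := fun i (hi : i ≠ 12) => run_of_notMem_writes neighbour 0 ρ A2 i
    (by simpa [neighbour, writes] using hi)
  generalize neighbour.run 0 ρ A2 = A3 at *
  have g3 : HoldsGraph G A3 := g2.congr (f3 0 (by norm_num)) (f3 2 (by norm_num))
  have m4 := run_distances hG hρ g3 (a := 4) (by norm_num) (by norm_num)
    (src := .cell 12 (.const 0)) (s := w)
    (fun B hB => by simp only [Expr.eval]; rw [hB 12 (by norm_num), m3])
  have f4 := fun i (hi : i ≠ 4) => run_of_notMem_writes (distances 4 (.cell 12 (.const 0))) 0 ρ A3 i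
    (by simpa [writes_distances] using hi)
  generalize (distances 4 (.cell 12 (.const 0))).run 0 ρ A3 = A4 at *
  have g4 : HoldsGraph G A4 := g3.congr (f4 0 (by norm_num)) (f4 2 (by norm_num))
  have d4 : ∀ v : Fin N, A4 3 v = G.dist r v := by
    intro v
    rw [f4 3 (by norm_num), f3 3 (by norm_num), m2]
  obtain ⟨c, m5, hc1, hc2⟩ := run_corner (A := A4) hρ hr
  have f5 := fun i (hi : i ≠ 13) => run_of_notMem_writes corner 0 ρ A4 i
    (by simpa [corner, writes] using hi)
  generalize corner.run 0 ρ A4 = A5 at *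
  have g5 : HoldsGraph G A5 := g4.congr (f5 0 (by norm_num)) (f5 2 (by norm_num))
  have m6 := run_distances hG hρ g5 (a := 5) (by norm_num) (by norm_num)
    (src := .cell 13 (.const 0)) (s := c)
    (fun B hB => by simp only [Expr.eval]; rw [hB 13 (by norm_num), m5])
  have f6 := fun i (hi : i ≠ 5) => run_of_notMem_writes (distances 5 (.cell 13 (.const 0))) 0 ρ A5 i
    (by simpa [writes_distances] using hi)
  generalize (distances 5 (.cell 13 (.const 0))).run 0 ρ A5 = A6 at *
  have d6 : ∀ v : Fin N, A6 3 v = G.dist r v := by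
    intro v
    rw [f6 3 (by norm_num), f5 3 (by norm_num), d4]
  have m7 := fun v => run_positions (ρ := ρ) (A := A6) v
  have f7 := fun i (hi : i ≠ 6) => run_of_notMem_writes positions 0 ρ A6 i
    (by simpa [positions, writes] using hi)
  generalize positions.run 0 ρ A6 = A7 at *
  have m8 := run_depth (A := A7) hρ (by simp [f7, f6, f5, f4, f3, f2, f1, hin])
  have f8 := fun i (hi : i ≠ 14) => run_of_notMem_writes depth 0 ρ A7 i
    (by simpa [depth, writes] using hi)
  generalize depth.run 0 ρ A7 = A8 at *
  obtain ⟨n', m', I', J', h', hmin, hmax, hIw, hJw⟩ := exists_gridCoord_of_adj h hw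
  rw [← hmin, ← hmax]
  clear hmin hmax h I J n m
  have hd := h'.dist_root
  -- The neighbour `w` has coordinates `(0, 1)`, so the vertices closer to `r` than to `w` form the
  -- side `J' = 0`, and the farthest of them is its other end. If `w = r`, no vertex is closer to
  -- `r` than to `w`, so `c = r`, which is that end because `n' = 1`.
  have hc : I' c + 1 = n' ∧ J' c = 0 := by
    have hr1 := h'.fst_root
    have hr2 := h'.snd_root
    have hcn := h'.fst_lt c
    have hcm := h'.snd_lt c
    rcases hJw with hJw | ⟨rfl, hn⟩
    · have key : ∀ v : Fin N, A4 3 v < A4 4 v ↔ J' v = 0 := by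
        intro v
        rw [d4, m4, hd, h'.dist_eq, hIw, hJw]
        omega
      obtain ⟨x, x1, x2⟩ := h'.surj (n' - 1) 0 (by omega) (by omega)
      have hx := hc2 x ((key x).2 x2)
      rw [d4, d4, hd, hd] at hx
      have hJc : J' c = 0 := by
        rcases hc1 with rfl | hc1
        · exact hr2
        · exact (key c).1 hc1
      omega
    · rcases hc1 with rfl | hc1
      · omega
      · rw [d4, m4] at hc1
        omega
  have hcI := hc.1
  have hcJ := hc.2
  have d8 : ∀ v : Fin N, A8 3 v = G.dist r v := by
    intro v
    rw [f8 3 (by norm_num), f7 3 (by norm_num), d6]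
  have hc8 : A8 13 0 = c := by
    rw [f8 13 (by norm_num), f7 13 (by norm_num), f6 13 (by norm_num), m5]
  have hdepth : A8 14 0 + 2 = n' + m' := by
    have hcm := h'.snd_lt c
    obtain ⟨x, x1, x2⟩ := h'.surj (n' - 1) (m' - 1) (by omega) (by omega)
    have h1 := m8.1 x
    rw [f7 3 (by norm_num), d6, hd] at h1
    rcases m8.2 with h2 | ⟨v, h2⟩
    · omega
    · rw [f7 3 (by norm_num), d6, hd] at h2
      have := h'.fst_lt v
      have := h'.snd_lt v
      omega
  have m9 := run_sides (ρ := ρ) (A := A8) (n := n') (m := m')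
    (by rw [hc8, d8, hd]; omega) (by rw [hc8, d8, hd]; omega)
  have f9 := fun i (hi : i ≠ 15 ∧ i ≠ 16) => run_of_notMem_writes sides 0 ρ A8 i
    (by simpa [sides, writes] using hi)
  generalize sides.run 0 ρ A8 = A9 at *
  have d9 : ∀ v : Fin N, A9 3 v = G.dist r v := by
    intro v
    rw [f9 3 (by norm_num), d8]
  have p9 : ∀ v : Fin N, A9 6 v = J' v - (I' v + J' v + 1 - n') := by
    intro v
    rw [f9 6 (by norm_num), f8 6 (by norm_num), m7 v (by rw [hρ]; exact v.2), hρ,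
      count_eq_card_filter_univ, ← h'.card_before hcI hcJ v]
    simp only [d6, m6]
  have s9 : HoldsSides N (min n' m') (max n' m') A9 := by
    refine ⟨fun u hu => ?_, m9.1, m9.2⟩
    simp [f9, f8, f7, f6, f5, f4, f3, f2, m1 u hu]
  have hcard : N = n' * m' := by
    rw [← h'.card_eq, Fintype.card_fin]
  have hn := h'.fst_lt r
  have hm := h'.snd_lt r
  have haN : min n' m' ≤ N := by
    refine (min_le_left _ _).trans ?_
    rw [hcard]
    exact Nat.le_mul_of_pos_right _ (by omega)
  -- From `(I' v + 1) * (J' v + 1) ≤ N`. It ensures that `N` rows suffice for tables indexed by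
  -- layers.
  have hdN : ∀ v : Fin N, G.dist r v < N := by
    intro v
    have h1 := h'.fst_lt v
    have h2 := h'.snd_lt v
    have h3 := Nat.mul_le_mul (show I' v + 1 ≤ n' from h1) (show J' v + 1 ≤ m' from h2)
    rw [← hcard, add_mul, mul_add] at h3
    rw [hd]
    omega
  have m10 := fun t (ht : t < min n' m') => run_merging (ρ := ρ) (A := A9) hρ s9
    (fun i => by simp [f9, f8, f7, f6, f5, f4, f3, f2, f1, hin]) haN ht
  have f10 := fun i (hi : i ≠ 7 ∧ i ≠ 8) => run_of_notMem_writes merging 0 ρ A9 i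
    (by simpa [merging, findIndex, writeSize, writes, and_comm] using hi)
  generalize merging.run 0 ρ A9 = A10 at *
  have s10 := s9.congr (f10 2 (by norm_num)) (f10 15 (by norm_num)) (f10 16 (by norm_num))
  have m11 := run_parents (ρ := ρ) hρ s10 m10
  have f11 := fun i (hi : i ≠ 9) => run_of_notMem_writes parents 0 ρ A10 i
    (by simpa [parents, writeParent, writes] using hi)
  generalize parents.run 0 ρ A10 = A11 at *
  have s11 := s10.congr (f11 2 (by norm_num)) (f11 15 (by norm_num)) (f11 16 (by norm_num))
  have m12 := run_rankPositions (ρ := ρ) hρ s11 (by omega)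
    (by rw [f11 8 (by norm_num)]; exact m10) m11
    (fun i => by simp [f11, f10, f9, f8, f7, f6, f5, f4, f3, f2, f1, hin])
  have f12 := fun i (hi : i ≠ 10) => run_of_notMem_writes rankPositions 0 ρ A11 i
    (by simpa [rankPositions, writePos, writes] using hi)
  generalize rankPositions.run 0 ρ A11 = A12 at *
  have s12 := s11.congr (f12 2 (by norm_num)) (f12 15 (by norm_num)) (f12 16 (by norm_num))
  have d12 : ∀ v : Fin N, A12 3 v = G.dist r v := by
    intro v
    rw [f12 3 (by norm_num), f11 3 (by norm_num), f10 3 (by norm_num), d9]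
  have p12 : ∀ v : Fin N, A12 6 v = J' v - (I' v + J' v + 1 - n') := by
    intro v
    rw [f12 6 (by norm_num), f11 6 (by norm_num), f10 6 (by norm_num), p9]
  have hL := h'.isLayered
  have hab : min n' m' ≤ max n' m' := min_le_max
  have m13 := fun v : Fin N => run_vertexRanks (ρ := ρ) hρ s12 haN
    (fun v hv => (d12 ⟨v, hv⟩).trans_lt (hdN _)) m12 v.2
    (by rw [d12, p12]; exact hL.exists_rank hab v)
  have f13 := fun i (hi : i ≠ 11) => run_of_notMem_writes vertexRanks 0 ρ A12 i
    (by simpa [vertexRanks, writes] using hi)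
  generalize vertexRanks.run 0 ρ A12 = A13 at *
  have s13 := s12.congr (f13 2 (by norm_num)) (f13 15 (by norm_num)) (f13 16 (by norm_num))
  simp only [d12, p12] at m13
  have d13 : ∀ v : Fin N, A13 3 v = G.dist r v := by
    intro v
    rw [f13 3 (by norm_num), d12]
  have m14 := run_edges (ρ := ρ) (A := A13) hρ s13.mul
    (fun v hv => (d13 ⟨v, hv⟩).trans_lt (hdN _))
    (fun v hv => ((mem_ranks.1 (m13 ⟨v, hv⟩).1).2.2).trans_le haN)
    (by rw [f13 9 (by norm_num), f12 9 (by norm_num)]; exact m11)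
  generalize edges.run 0 ρ A13 = A14 at *
  refine ⟨fun v => A13 11 v, hL.isRanking hG hab (fun v => (m13 v).1) (fun v => (m13 v).2)
    fun u v => ?_⟩
  have e1 := m14 u u.2 v v.2
  have e2 := m14 v v.2 u u.2
  rw [d13, d13] at e1 e2
  rw [output, SimpleGraph.fromRel_adj, e1, e2, and_iff_right_iff_imp]
  -- The condition `u ≠ v` of `fromRel` is automatic, because the two ends lie in consecutive
  -- layers.
  rintro hh rfl
  omega

end Cmd

end Ram

theorem theorem3 :
    ∃ (A : Ram.Program) (p : Polynomial ℕ) (ε : ℕ → ℝ), Tendsto ε atTop (𝓝 0) ∧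
      ∀ (n m N : ℕ) (G : SimpleGraph (Fin N)) (r : Fin N), 1 ≤ n → 1 ≤ m →
        IsGridWithCorner n m G r →
        ∃ (s : Ram.Store) (t : ℕ), Ram.Exec A (Ram.input G r) s t ∧ t ≤ p.eval N ∧
          IsSpanningTree G (Ram.output N s) ∧
          IsMinMinTree (min n m) (max n m) G r (Ram.output N s) ∧
          ∀ T : SimpleGraph (Fin N), IsSpanningTree G T →
            loss (Ram.output N s) r (fun _ => 1) (fun _ => 1) ≤
              (9 / 8 + ε N) * loss T r (fun _ => 1) (fun _ => 1) := by
  refine ⟨Ram.Cmd.minMin.compile 0, Ram.Cmd.minMin.bound, approxError, tendsto_approxError, ?_⟩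
  intro n m N G r _ _ hgrid
  obtain ⟨I, J, h⟩ := hgrid.exists_gridCoord
  obtain ⟨rank, hrank⟩ := Ram.Cmd.isRanking_output h
  obtain ⟨t, ht, htb⟩ := Ram.Cmd.exec_compile Ram.Cmd.minMin 0 (Ram.input G r).reg
    (Ram.input G r).arr (fun i hi => by simp [Ram.input, show i ≠ 0 by omega, show i ≠ 1 by omega])
  refine ⟨_, t, ht, htb, hrank.spanning, hrank.isMinMinTree, fun T hT => ?_⟩
  have := h.loss_le hrank hT
  rwa [Fintype.card_fin] at this
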